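/- Let $d\ge 1$ and $\kappa\in\mathbb N$ with $\kappa>\frac d2$. Let $\phi\in C_c^\infty(B(0,1))$ on $\mathbb R^d$ be real-valued with $\int\phi=1$ and $\int\phi(x)x^\gamma\,dx=0$ for all multi-indices $0<|\gamma|<\kappa$, and put $\phi_t(x)=t^{-d}\phi(x/t)$. Let $\{h^a\}_{a\in\Gamma}$ be an orthonormal basis, with respect to the $L^2$ inner product, of the space of real-valued functions of the form $\sum_{Q'}\mathbf 1_{Q'}p_{Q'}$, where $Q'$ runs over the $2^d$ dyadic children of $[0,1)^d$ and the $p_{Q'}$ are polynomials of degree at most $\kappa-1$, whose moments $\int f(x)x^\beta\,dx$, $|\beta|\le\kappa-1$, all vanish. For a dyadic grid $\mathcal G$ in $\mathbb R^d$ (nested lattice tilings by half-open cubes of side lengths $2^{-s}$, $s\in\mathbb Z$) and a cube $I\in\mathcal G$, let $h_I^a$ be the $L^2$-normalized translate and dilate of $h^a$ to $I$, and for $\eta>0$ let $h_I^{a,\eta}=h_I^a*\phi_{\eta\ell(I)}$ be the smooth Alpert wavelets. With $\langle f,g\rangle=\int fg$ for real-valued $g$, define on real- or complex-valued $L^p(\mathbb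 R^d)$ $$Sf=\sum_{I\in\mathcal G,\,a\in\Gamma}\langle f,h_I^a\rangle h_I^{a,\eta},\qquad S^*f=\sum_{I\in\mathcal G,\,a\in\Gamma}\langle f,h_I^{a,\eta}\rangle h_I^{a},\qquad T=SS^*.$$ We say that $T^{-1}$ is defined on $L^p$ if both series converge unconditionally in $L^p$ for every $f\in L^p$ and $S$, $S^*$ are bounded invertible linear operators on $L^p$. In that case, for $s\in\mathbb Z$ and a bounded set $U\subset\mathbb R^d$ (for instance a cube), define the doubly smooth Alpert pseudoprojection $$\mathsf Q^\eta_{s,U}f=\sum_{I\in\mathcal G_s[U]}\ \sum_{a\in\Gamma}\langle T^{-1}f,h_I^{a,\eta}\rangle\,h_I^{a,\eta},$$ where $\mathcal G_s[U]$ is the set of the cubes of $\mathcal G$ of side length $2^{-s}$ that are contained in $U$. 1. There is $\eta_0>0$, depending only on $d$, $\kappa$, $\phi$ (and on whether the scalars are real or complex), such that $T^{-1}$ is defined on $L^2(\mathbb R^d)$ for every grid $\mathcal G$, every choice of the basis $\{h^a\}$, and every $0<\eta<\eta_0$. 2. For every $\mathcal G$, $\{h^a\}$, $\eta>0$ and $1<p<\infty$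 such that $T^{-1}$ is defined on $L^p(\mathbb R^d)$ (hence in particular for $p=2$ and $0<\eta<\eta_0$), one has the biorthogonality $$\langle T^{-1}h_I^{a,\eta},h_J^{b,\eta}\rangle=\begin{cases}1&\text{if }(I,a)=(J,b),\\0&\text{otherwise,}\end{cases}\qquad I,J\in\mathcal G,\ a,b\in\Gamma,$$ and, for all $s$ and $U$, $\mathsf Q^\eta_{s,U}$ is an (oblique) projection on $L^p(\mathbb R^d)$: a bounded linear operator with $(\mathsf Q^\eta_{s,U})^2=\mathsf Q^\eta_{s,U}$. The same holds if $\mathcal G_s[U]$ is instead the set of the cubes of $\mathcal G$ of side length $2^{-s}$ that meet $U$. -/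

import Mathlib

open MeasureTheory
open scoped ENNReal ContDiff

/-- Euclidean space `ℝ^d`. -/
abbrev RSpace (d : ℕ) : Type := EuclideanSpace ℝ (Fin d)

/-- The half-open axis-parallel cube with lower corner `c` and side length `ℓ`. -/
def halfOpenCube {d : ℕ} (c : RSpace d) (ℓ : ℝ) : Set (RSpace d) :=
  {x | ∀ i, c i ≤ x i ∧ x i < c i + ℓ}

/-- The monomial `x ^ β`. -/
def monom {d : ℕ} (β : Fin d → ℕ) (x : RSpace d) : ℝ := ∏ i, x i ^ β i

/-- The unit cube `[0,1)^d`. -/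
def unitCube (d : ℕ) : Set (RSpace d) := halfOpenCube 0 1

/-- The `2 ^ d` dyadic children of the unit cube, indexed by `{0,1}^d`. -/
def unitChild {d : ℕ} (ε : Fin d → Fin 2) : Set (RSpace d) :=
  halfOpenCube (WithLp.toLp 2 fun i => ((ε i : ℕ) : ℝ) / 2) (1 / 2)

/-- The Alpert space of the unit cube: sums of indicators of the children times polynomials of
degree at most `κ - 1`, with vanishing moments `∫ f x^β` for all multi-indices `|β| ≤ κ - 1`. -/
def alpertSpace (d κ : ℕ) : Set (RSpace d → ℝ) :=
  {f | (∃ P : (Fin d → Fin 2) → MvPolynomial (Fin d) ℝ,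
          (∀ ε, (P ε).totalDegree < κ) ∧
          f = fun x => ∑ ε, (unitChild ε).indicator (fun y => MvPolynomial.eval (y ·) (P ε)) x) ∧
       ∀ β : Fin d → ℕ, ∑ i, β i < κ → ∫ x in unitCube d, f x * monom β x = 0}

/-- The unit wavelets `h^a`, `a ∈ Γ = {0, …, N-1}`: an orthonormal basis (with respect to the
`L²` inner product) of the Alpert space of the unit cube. -/
structure AlpertBasis (d κ N : ℕ) where
  h : Fin N → RSpace d → ℝ
  mem : ∀ a, h a ∈ alpertSpace d κ
  orthonormal : ∀ a b, ∫ x, h a x * h b x = if a = b then 1 else 0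
  spanning : ∀ f ∈ alpertSpace d κ, f ∈ Submodule.span ℝ (Set.range h)

/-- `φ ∈ C_c^∞(B(0,1))` with unit integral and vanishing moments of positive order less
than `κ`. -/
structure AlpertMollifier (d κ : ℕ) where
  φ : RSpace d → ℝ
  smooth : ContDiff ℝ ∞ φ
  support : tsupport φ ⊆ Metric.ball 0 1
  integral_eq_one : ∫ x, φ x = 1
  moments : ∀ β : Fin d → ℕ, 0 < ∑ i, β i → ∑ i, β i < κ → ∫ x, φ x * monom β x = 0

/-- `φ_t(x) = t^{-d} φ(x / t)`. -/
noncomputable def dilate {d : ℕ} (φ : RSpace d → ℝ) (t : ℝ) (x : RSpace d) : ℝ :=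
  (t ^ d)⁻¹ * φ (t⁻¹ • x)

/-- A dyadic grid in `ℝ^d`: for each `s ∈ ℤ` the lattice tiling of `ℝ^d` by half-open cubes of side
`2^{-s}` having `offset s` as a vertex, such that each tiling refines the preceding one. -/
structure DyadicGrid (d : ℕ) where
  offset : ℤ → RSpace d
  nested : ∀ s : ℤ, ∃ n : Fin d → ℤ, ∀ i,
    offset s i - offset (s + 1) i = (2 : ℝ) ^ (-(s + 1)) * (n i : ℝ)

/-- The cubes of a grid are indexed by `(s, m)`: `2^{-s}` is the side length and `m` the position
in the lattice. -/
abbrev CubeIndex (d : ℕ) : Type := ℤ × (Fin d → ℤ)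

/-- Side length. -/
noncomputable def CubeIndex.side {d : ℕ} (I : CubeIndex d) : ℝ := (2 : ℝ) ^ (-I.1)

lemma CubeIndex.side_pos {d : ℕ} (I : CubeIndex d) : 0 < CubeIndex.side I := by
  unfold CubeIndex.side; positivity

namespace DyadicGrid

variable {d : ℕ}

/-- Lower corner of the cube with index `I`. -/
noncomputable def corner (G : DyadicGrid d) (I : CubeIndex d) : RSpace d :=
  WithLp.toLp 2 fun i => G.offset I.1 i + CubeIndex.side I * (I.2 i : ℝ)

/-- The cube with index `I`. -/
noncomputable def cube (G : DyadicGrid d) (I : CubeIndex d) : Set (RSpace d) :=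
  halfOpenCube (G.corner I) (CubeIndex.side I)

lemma finite_meeting (G : DyadicGrid d) (s : ℤ) (U : Set (RSpace d))
    (hU : Bornology.IsBounded U) : {m : Fin d → ℤ | (G.cube (s, m) ∩ U).Nonempty}.Finite := by
  obtain ⟨R, hR⟩ := hU.subset_closedBall 0
  have hs : (0 : ℝ) < (2 : ℝ) ^ (-s) := by positivity
  set ℓ : ℝ := (2 : ℝ) ^ (-s) with hℓ
  refine (Set.Finite.pi' (ι := Fin d) (t := fun i =>
    Set.Icc ⌊(-R - G.offset s i - ℓ) / ℓ⌋ ⌈(R - G.offset s i) / ℓ⌉)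
    (fun i => Set.finite_Icc _ _)).subset ?_
  rintro m ⟨x, hx, hxU⟩ i
  have hxR : ‖x‖ ≤ R := by simpa using hR hxU
  have hxi : |x i| ≤ R := by
    have := PiLp.norm_apply_le x i
    rw [Real.norm_eq_abs] at this
    exact this.trans hxR
  have h2 := hx i
  simp only [corner, CubeIndex.side, ← hℓ] at h2
  have h3 := abs_le.mp hxi
  have key : (-R - G.offset s i - ℓ) / ℓ ≤ (m i : ℝ) ∧ (m i : ℝ) ≤ (R - G.offset s i) / ℓ := by
    constructor
    · rw [div_le_iff₀ hs]; nlinarith [h2.1, h2.2, h3.1, h3.2]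
    · rw [le_div_iff₀ hs]; nlinarith [h2.1, h2.2, h3.1, h3.2]
  constructor
  · exact_mod_cast (Int.floor_le _).trans key.1
  · exact_mod_cast key.2.trans (Int.le_ceil _)

lemma finite_inside (G : DyadicGrid d) (s : ℤ) (U : Set (RSpace d))
    (hU : Bornology.IsBounded U) : {m : Fin d → ℤ | G.cube (s, m) ⊆ U}.Finite := by
  refine (G.finite_meeting s U hU).subset fun m hm => ?_
  have hc : G.corner (s, m) ∈ G.cube (s, m) := fun i =>
    ⟨le_rfl, by linarith [CubeIndex.side_pos ((s, m) : CubeIndex d)]⟩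
  exact ⟨_, hc, hm hc⟩

/-- The cubes of the grid of side `2^{-s}` that are contained in `U`. -/
noncomputable def cubesInside (G : DyadicGrid d) (s : ℤ) {U : Set (RSpace d)}
    (hU : Bornology.IsBounded U) : Finset (Fin d → ℤ) :=
  (G.finite_inside s U hU).toFinset

/-- The cubes of the grid of side `2^{-s}` that meet `U`. -/
noncomputable def cubesMeeting (G : DyadicGrid d) (s : ℤ) {U : Set (RSpace d)}
    (hU : Bornology.IsBounded U) : Finset (Fin d → ℤ) :=
  (G.finite_meeting s U hU).toFinset

end DyadicGrid

namespace AlpertBasis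

variable {d κ N : ℕ}

/-- The Alpert wavelet `h_I^a`: the `L²`-normalized translate and dilate of `h^a` to the
cube `I`. -/
noncomputable def wavelet (w : AlpertBasis d κ N) (G : DyadicGrid d) (I : CubeIndex d)
    (a : Fin N) (x : RSpace d) : ℝ :=
  (√(CubeIndex.side I ^ d))⁻¹ * w.h a ((CubeIndex.side I)⁻¹ • (x - G.corner I))

/-- The smooth Alpert wavelet `h_I^{a,η} = h_I^a ∗ φ_{η ℓ(I)}`. -/
noncomputable def smoothWavelet (w : AlpertBasis d κ N) (G : DyadicGrid d) (φ : RSpace d → ℝ)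
    (η : ℝ) (I : CubeIndex d) (a : Fin N) : RSpace d → ℝ :=
  convolution (w.wavelet G I a) (dilate φ (η * CubeIndex.side I))
    (ContinuousLinearMap.lsmul ℝ ℝ) volume

end AlpertBasis

lemma measurableSet_halfOpenCube {d : ℕ} (c : RSpace d) (ℓ : ℝ) :
    MeasurableSet (halfOpenCube c ℓ) := by
  have : halfOpenCube c ℓ = ⋂ i, {x : RSpace d | c i ≤ x i ∧ x i < c i + ℓ} := by
    ext x; simp [halfOpenCube]
  rw [this]
  refine MeasurableSet.iInter fun i => ?_
  have hm : Measurable fun x : RSpace d => x i := by fun_prop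
  exact (measurableSet_le measurable_const hm).inter (measurableSet_lt hm measurable_const)

lemma isBounded_halfOpenCube {d : ℕ} (c : RSpace d) (ℓ : ℝ) :
    Bornology.IsBounded (halfOpenCube c ℓ) := by
  have hb : Bornology.IsBounded
      (Set.pi Set.univ fun i => Set.Icc (c i) (c i + ℓ) : Set (Fin d → ℝ)) :=
    Bornology.IsBounded.pi fun i => Metric.isBounded_Icc _ _
  have := (PiLp.antilipschitzWith_ofLp 2 (fun _ : Fin d => ℝ)).isBounded_preimage hb
  refine this.subset fun x hx => ?_
  simp only [Set.mem_preimage, Set.mem_pi]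
  exact fun i _ => ⟨(hx i).1, (hx i).2.le⟩

lemma continuous_evalPoly {d : ℕ} (P : MvPolynomial (Fin d) ℝ) :
    Continuous fun y : RSpace d => MvPolynomial.eval (y ·) P := by
  have h1 := MvPolynomial.continuous_eval P
  exact h1.comp (by fun_prop)

/-- Functions in the Alpert space are measurable, bounded and compactly supported. -/
lemma alpertSpace_nice {d κ : ℕ} {f : RSpace d → ℝ} (hf : f ∈ alpertSpace d κ) :
    Measurable f ∧ (∃ C, ∀ x, |f x| ≤ C) ∧ HasCompactSupport f := by
  obtain ⟨⟨P, -, rfl⟩, -⟩ := hf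
  have bdd : ∀ ε : Fin d → Fin 2, ∃ C, ∀ x,
      |(unitChild ε).indicator (fun y => MvPolynomial.eval (y ·) (P ε)) x| ≤ C := by
    intro ε
    have hK : IsCompact (closure (unitChild ε)) :=
      (isBounded_halfOpenCube _ _).isCompact_closure
    obtain ⟨C, hC⟩ := hK.exists_bound_of_continuousOn (continuous_evalPoly (P ε)).continuousOn
    refine ⟨max C 0, fun x => ?_⟩
    by_cases hx : x ∈ unitChild ε
    · rw [Set.indicator_of_mem hx]
      exact (hC x (subset_closure hx)).trans (le_max_left _ _)
    · rw [Set.indicator_of_notMem hx]; simp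
  choose C hC using bdd
  refine ⟨?_, ⟨∑ ε, C ε, fun x => ?_⟩, ?_⟩
  · exact Finset.measurable_fun_sum _ fun ε _ =>
      (continuous_evalPoly (P ε)).measurable.indicator (measurableSet_halfOpenCube _ _)
  · exact (Finset.abs_sum_le_sum_abs _ _).trans (Finset.sum_le_sum fun ε _ => hC ε x)
  · have hb : Bornology.IsBounded (⋃ ε : Fin d → Fin 2, unitChild ε) :=
      Bornology.isBounded_iUnion.2 fun ε => isBounded_halfOpenCube _ _
    refine HasCompactSupport.of_support_subset_isCompact hb.isCompact_closure ?_
    intro x hx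
    refine subset_closure ?_
    by_contra hcon
    apply hx
    refine Finset.sum_eq_zero fun ε _ => Set.indicator_of_notMem (fun h => hcon ?_) _
    exact Set.mem_iUnion.2 ⟨ε, h⟩

namespace AlpertBasis

variable {d κ N : ℕ} (w : AlpertBasis d κ N) (G : DyadicGrid d)

lemma wavelet_nice (I : CubeIndex d) (a : Fin N) :
    Measurable (w.wavelet G I a) ∧ (∃ C, ∀ x, |w.wavelet G I a x| ≤ C) ∧
      HasCompactSupport (w.wavelet G I a) := by
  obtain ⟨hm, ⟨C, hC⟩, hs⟩ := alpertSpace_nice (w.mem a)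
  refine ⟨?_, ⟨|(√(CubeIndex.side I ^ d))⁻¹| * C, fun x => ?_⟩, ?_⟩
  · unfold wavelet
    exact (hm.comp (by fun_prop)).const_mul _
  · unfold wavelet
    rw [abs_mul]
    exact mul_le_mul_of_nonneg_left (hC _) (abs_nonneg _)
  · have hne : (CubeIndex.side I)⁻¹ ≠ 0 := inv_ne_zero (CubeIndex.side_pos I).ne'
    have h1 := (hs.comp_smul hne).comp_homeomorph (Homeomorph.subRight (G.corner I))
    exact h1.mul_left (f := fun _ => (√(CubeIndex.side I ^ d))⁻¹)

lemma memLp_of_nice {𝕜 : Type*} [RCLike 𝕜] {g : RSpace d → ℝ} (hm : AEStronglyMeasurable g volume)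
    (hb : ∃ C, ∀ x, |g x| ≤ C) (hs : HasCompactSupport g) (p : ℝ≥0∞) :
    MemLp (fun x => (g x : 𝕜)) p (volume : Measure (RSpace d)) := by
  obtain ⟨C, hC⟩ := hb
  have h1 : MemLp g p (volume : Measure (RSpace d)) := by
    exact hs.memLp_of_bound hm C (Filter.Eventually.of_forall fun x => hC x)
  exact h1.ofReal

lemma memLp_wavelet (𝕜 : Type*) [RCLike 𝕜] (p : ℝ≥0∞) (I : CubeIndex d) (a : Fin N) :
    MemLp (fun x => (w.wavelet G I a x : 𝕜)) p (volume : Measure (RSpace d)) := by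
  obtain ⟨hm, hb, hs⟩ := w.wavelet_nice G I a
  exact memLp_of_nice hm.aestronglyMeasurable hb hs p

lemma memLp_smoothWavelet (𝕜 : Type*) [RCLike 𝕜] (p : ℝ≥0∞) (Φ : AlpertMollifier d κ)
    {η : ℝ} (hη : 0 < η) (I : CubeIndex d) (a : Fin N) :
    MemLp (fun x => (w.smoothWavelet G Φ.φ η I a x : 𝕜)) p (volume : Measure (RSpace d)) := by
  obtain ⟨hm, ⟨C, hC⟩, hs⟩ := w.wavelet_nice G I a
  have ht : (η * CubeIndex.side I)⁻¹ ≠ 0 :=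
    inv_ne_zero (mul_pos hη (CubeIndex.side_pos I)).ne'
  have hφs : HasCompactSupport Φ.φ :=
    (Metric.isBounded_ball.subset Φ.support).isCompact_closure.of_isClosed_subset
      (isClosed_tsupport Φ.φ) subset_closure
  have hds : HasCompactSupport (dilate Φ.φ (η * CubeIndex.side I)) :=
    (hφs.comp_smul ht).mul_left (f := fun _ => ((η * CubeIndex.side I) ^ d)⁻¹)
  have hdc : Continuous (dilate Φ.φ (η * CubeIndex.side I)) := by
    unfold dilate
    exact continuous_const.mul (Φ.smooth.continuous.comp (by fun_prop))
  have hint : Integrable (w.wavelet G I a) (volume : Measure (RSpace d)) := by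
    rw [← memLp_one_iff_integrable]
    exact hs.memLp_of_bound hm.aestronglyMeasurable C (Filter.Eventually.of_forall fun x => hC x)
  have hcc : Continuous (w.smoothWavelet G Φ.φ η I a) :=
    hds.continuous_convolution_right _ hint.locallyIntegrable hdc
  have hcs : HasCompactSupport (w.smoothWavelet G Φ.φ η I a) := hs.convolution _ hds
  obtain ⟨D, hD⟩ := hcc.bounded_above_of_compact_support hcs
  exact memLp_of_nice hcc.aestronglyMeasurable ⟨D, fun x => hD x⟩ hcs p

end AlpertBasis

/-- The pairing `⟨f, g⟩ = ∫ f g` of `f ∈ L^p` with a real-valued function `g`. -/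
noncomputable def pairing {d : ℕ} {𝕜 : Type*} [RCLike 𝕜] {p : ℝ≥0∞}
    (f : Lp 𝕜 p (volume : Measure (RSpace d))) (g : RSpace d → ℝ) : 𝕜 :=
  ∫ x, f x * (g x : 𝕜)

/-- The data of a smooth Alpert system built from the mollifier `Φ`: the unit wavelets, the
parameter `η > 0`, and the grid. -/
structure SmoothAlpert {d κ : ℕ} (Φ : AlpertMollifier d κ) (N : ℕ) where
  w : AlpertBasis d κ N
  η : ℝ
  η_pos : 0 < η
  G : DyadicGrid d

namespace SmoothAlpert

variable {d κ N : ℕ} {Φ : AlpertMollifier d κ} (A : SmoothAlpert Φ N)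
variable (𝕜 : Type*) [RCLike 𝕜] (p : ℝ≥0∞) [Fact (1 ≤ p)]

/-- `h_I^a` as a function; the index is the pair `(I, a)`. -/
noncomputable def h (k : CubeIndex d × Fin N) : RSpace d → ℝ := A.w.wavelet A.G k.1 k.2

/-- `h_I^{a,η}` as a function; the index is the pair `(I, a)`. -/
noncomputable def hη (k : CubeIndex d × Fin N) : RSpace d → ℝ :=
  A.w.smoothWavelet A.G Φ.φ A.η k.1 k.2

/-- `h_I^a` as an element of `L^p`. -/
noncomputable def hLp (k : CubeIndex d × Fin N) : Lp 𝕜 p (volume : Measure (RSpace d)) :=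
  (A.w.memLp_wavelet A.G 𝕜 p k.1 k.2).toLp

/-- `h_I^{a,η}` as an element of `L^p`. -/
noncomputable def hηLp (k : CubeIndex d × Fin N) : Lp 𝕜 p (volume : Measure (RSpace d)) :=
  (A.w.memLp_smoothWavelet A.G 𝕜 p Φ A.η_pos k.1 k.2).toLp

variable {𝕜 p}

/-- The terms of the series defining `S f`. -/
noncomputable def termS (f : Lp 𝕜 p (volume : Measure (RSpace d))) (k : CubeIndex d × Fin N) :
    Lp 𝕜 p (volume : Measure (RSpace d)) :=
  pairing f (A.h k) • A.hηLp 𝕜 p k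

/-- The terms of the series defining `S* f`. -/
noncomputable def termSstar (f : Lp 𝕜 p (volume : Measure (RSpace d)))
    (k : CubeIndex d × Fin N) : Lp 𝕜 p (volume : Measure (RSpace d)) :=
  pairing f (A.hη k) • A.hLp 𝕜 p k

/-- `S f = ∑_{I,a} ⟨f, h_I^a⟩ h_I^{a,η}`. -/
noncomputable def S (f : Lp 𝕜 p (volume : Measure (RSpace d))) :
    Lp 𝕜 p (volume : Measure (RSpace d)) :=
  ∑' k, A.termS f k

/-- `S* f = ∑_{I,a} ⟨f, h_I^{a,η}⟩ h_I^a`. -/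
noncomputable def Sstar (f : Lp 𝕜 p (volume : Measure (RSpace d))) :
    Lp 𝕜 p (volume : Measure (RSpace d)) :=
  ∑' k, A.termSstar f k

/-- `T = S S*`. -/
noncomputable def T (f : Lp 𝕜 p (volume : Measure (RSpace d))) :
    Lp 𝕜 p (volume : Measure (RSpace d)) :=
  A.S (A.Sstar f)

/-- `T⁻¹`; it is the two-sided inverse of `T` whenever `T` is bijective. -/
noncomputable def Tinv : Lp 𝕜 p (volume : Measure (RSpace d)) →
    Lp 𝕜 p (volume : Measure (RSpace d)) :=
  Function.invFun A.T

variable (𝕜 p)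

/-- The series defining `S` and `S*` converge (unconditionally) in `L^p`, and `S` and `S*` are
bounded invertible linear operators on `L^p`. In particular, `T = S S*` is one too. -/
def BoundedInvertible : Prop :=
  (∀ f : Lp 𝕜 p (volume : Measure (RSpace d)), Summable (A.termS f)) ∧
  (∀ f : Lp 𝕜 p (volume : Measure (RSpace d)), Summable (A.termSstar f)) ∧
  (∃ e : Lp 𝕜 p (volume : Measure (RSpace d)) ≃L[𝕜] Lp 𝕜 p (volume : Measure (RSpace d)),
    ∀ f, e f = A.S f) ∧
  (∃ e : Lp 𝕜 p (volume : Measure (RSpace d)) ≃L[𝕜] Lp 𝕜 p (volume : Measure (RSpace d)),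
    ∀ f, e f = A.Sstar f)

variable {𝕜 p}

/-- The pseudoprojection `∑_{I, a} ⟨T⁻¹ f, h_I^{a,η}⟩ h_I^{a,η}`, where `I` runs over the cubes of
side `2^{-s}` with positions in `F`. -/
noncomputable def pseudoproj (s : ℤ) (F : Finset (Fin d → ℤ))
    (f : Lp 𝕜 p (volume : Measure (RSpace d))) : Lp 𝕜 p (volume : Measure (RSpace d)) :=
  ∑ m ∈ F, ∑ a : Fin N, pairing (A.Tinv f) (A.hη ((s, m), a)) • A.hηLp 𝕜 p ((s, m), a)

/-- `Q_{s,U}^η`, with `G_s[U]` the set of the cubes of `G` of side `2^{-s}` contained in `U`. -/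
noncomputable def QInside (s : ℤ) {U : Set (RSpace d)} (hU : Bornology.IsBounded U) :
    Lp 𝕜 p (volume : Measure (RSpace d)) → Lp 𝕜 p (volume : Measure (RSpace d)) :=
  A.pseudoproj s (A.G.cubesInside s hU)

/-- `Q_{s,U}^η`, with `G_s[U]` the set of the cubes of `G` of side `2^{-s}` that meet `U`. -/
noncomputable def QMeeting (s : ℤ) {U : Set (RSpace d)} (hU : Bornology.IsBounded U) :
    Lp 𝕜 p (volume : Measure (RSpace d)) → Lp 𝕜 p (volume : Measure (RSpace d)) :=
  A.pseudoproj s (A.G.cubesMeeting s hU)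

end SmoothAlpert

/-- `Q` is a bounded linear operator on `L^p` with `Q² = Q`. -/
def IsBoundedProjection {d : ℕ} {𝕜 : Type*} [RCLike 𝕜] {p : ℝ≥0∞} [Fact (1 ≤ p)]
    (Q : Lp 𝕜 p (volume : Measure (RSpace d)) → Lp 𝕜 p (volume : Measure (RSpace d))) : Prop :=
  (∃ P : Lp 𝕜 p (volume : Measure (RSpace d)) →L[𝕜] Lp 𝕜 p (volume : Measure (RSpace d)),
    ∀ f, P f = Q f) ∧
  ∀ f, Q (Q f) = Q f

/-! Write `k = (I, a)`. Biorthogonality and the projection property are algebra. Orthonormality of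
the wavelets gives S h_k = h_k^η and ⟨S* f, h_k⟩ = ⟨f, h_k^η⟩. Hence ⟨T⁻¹ h_j^η, h_k^η⟩ = ⟨S* T⁻¹
h_j^η, h_k⟩ = ⟨S⁻¹ h_j^η, h_k⟩ = ⟨h_j, h_k⟩ (`pairing_Tinv_hηLp`). The pseudoprojection is a finite
sum of bounded rank-one operators which therefore fixes every h_k^η in its sum, so it is idempotent
(`isBoundedProjection_pseudoproj`).

For invertibility on L², let R be the operator with R h_k = h_k - h_k^η. The wavelets form a Hilbert
basis, S = 1 - R and S* = 1 - R^*, so a Neumann series finishes the proof once ‖R‖ < 1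
(`boundedInvertible_of_bound`). Split f into its parts v_s at scale 2^{-s}; then R v_s = x_s = v_s -
φ_{η 2^{-s}} * v_s. A piecewise polynomial with jumps has an L² modulus of continuity of order 1/2,
so ‖x_s‖ ≲ √η ‖v_s‖ and ⟨x_s, x_t⟩ ≲ η ‖v_s‖ ‖v_t‖. On the other hand, the finer of v_s, v_t has
mean zero on the cubes of its scale, where the coarser one oscillates little; this gives ⟨x_s, x_t⟩
≲ 2^{-|s-t|/2} ‖v_s‖ ‖v_t‖. The geometric mean of the two bounds is √η 2^{-|s-t|/4}, which is
summable over t, and Schur's test yields ‖R‖² ≲ √η (`exists_norm_inner_sub_mollify_le`,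
`exists_norm_sq_sum_sub_le`). The constants come from the Alpert space and φ alone, whence the
uniformity in the grid and the basis.

Completeness (`exists_hilbertBasis`): if f is orthogonal to all wavelets, then ⟨f, 1_J⟩ does not
change when 1_J is replaced by its polynomial projection on an ancestor I of J, because projections
on successive ancestors differ by an Alpert function. The projection has L² norm ≲ |J| |I|^{-1/2},
which tends to 0, so f has integral zero over every cube and f = 0. Whether the ancestors exhaust
ℝ^d plays no role. -/

/-! ### Geometry of dyadic grids. -/

namespace DyadicGrid

variable {d : ℕ}

/-- The affine map that carries the cube with index `I` to the unit cube. -/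
noncomputable def chart (G : DyadicGrid d) (I : CubeIndex d) (x : RSpace d) : RSpace d :=
  (CubeIndex.side I)⁻¹ • (x - G.corner I)

lemma chart_apply (G : DyadicGrid d) (I : CubeIndex d) (x : RSpace d) (i : Fin d) :
    G.chart I x i = (x i - G.corner I i) / CubeIndex.side I := by
  simp [chart, div_eq_inv_mul]

lemma mem_unitCube_iff {x : RSpace d} : x ∈ unitCube d ↔ ∀ i, 0 ≤ x i ∧ x i < 1 := by
  simp [unitCube, halfOpenCube]

lemma mem_unitChild_iff {x : RSpace d} {ε : Fin d → Fin 2} :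
    x ∈ unitChild ε ↔ ∀ i, ((ε i : ℕ) : ℝ) / 2 ≤ x i ∧ x i < ((ε i : ℕ) : ℝ) / 2 + 1 / 2 := by
  simp [unitChild, halfOpenCube]

lemma mem_cube_iff (G : DyadicGrid d) (I : CubeIndex d) (x : RSpace d) :
    x ∈ G.cube I ↔ G.chart I x ∈ unitCube d := by
  have h := CubeIndex.side_pos I
  rw [mem_unitCube_iff]
  refine forall_congr' fun i => ?_
  rw [chart_apply, le_div_iff₀ h, div_lt_iff₀ h]
  constructor <;> rintro ⟨h1, h2⟩ <;> constructor <;> linarith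

lemma existsUnique_mem_cube (G : DyadicGrid d) (s : ℤ) (x : RSpace d) :
    ∃! m, x ∈ G.cube (s, m) := by
  have h := CubeIndex.side_pos ((s, 0) : CubeIndex d)
  have key : ∀ m, x ∈ G.cube (s, m) ↔
      ∀ i, ⌊(x i - G.offset s i) / CubeIndex.side ((s, 0) : CubeIndex d)⌋ = m i := by
    intro m
    refine forall_congr' fun i => ?_
    rw [Int.floor_eq_iff, le_div_iff₀ h, div_lt_iff₀ h]
    have h2 : G.corner (s, m) i = G.offset s i + CubeIndex.side ((s, 0) : CubeIndex d) * m i := rfl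
    have h3 : CubeIndex.side (s, m) = CubeIndex.side ((s, 0) : CubeIndex d) := rfl
    rw [h2, h3]
    constructor <;> rintro ⟨h1, h2⟩ <;> constructor <;> linarith
  refine ⟨fun i => ⌊(x i - G.offset s i) / CubeIndex.side ((s, 0) : CubeIndex d)⌋,
    (key _).2 fun i => rfl, fun m hm => funext fun i => ((key m).1 hm i).symm⟩

lemma disjoint_cube (G : DyadicGrid d) (s : ℤ) {m m' : Fin d → ℤ} (h : m ≠ m') :
    Disjoint (G.cube (s, m)) (G.cube (s, m')) :=
  Set.disjoint_left.2 fun x hx hx' => h ((G.existsUnique_mem_cube s x).unique hx hx')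

lemma iUnion_cube (G : DyadicGrid d) (s : ℤ) : ⋃ m, G.cube (s, m) = Set.univ :=
  Set.eq_univ_of_forall fun x => Set.mem_iUnion.2 (G.existsUnique_mem_cube s x).exists

lemma measurableSet_cube (G : DyadicGrid d) (I : CubeIndex d) : MeasurableSet (G.cube I) :=
  measurableSet_halfOpenCube _ _

lemma side_succ (s : ℤ) (m m' : Fin d → ℤ) :
    CubeIndex.side ((s, m) : CubeIndex d) = 2 * CubeIndex.side ((s + 1, m') : CubeIndex d) := by
  simp only [CubeIndex.side]
  rw [show -s = -(s + 1) + 1 by ring, zpow_add_one₀ two_ne_zero]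
  ring

/-- In the lattice of level `s + 1` the offset of level `s` has position `n`, so the children of the
cube at `m` sit at `n + 2m + ε`. -/
lemma mem_child_iff (G : DyadicGrid d) {s : ℤ} {n : Fin d → ℤ}
    (hn : ∀ i, G.offset s i - G.offset (s + 1) i = (2 : ℝ) ^ (-(s + 1)) * (n i : ℝ))
    {m m' : Fin d → ℤ} {ε : Fin d → Fin 2} (h : ∀ i, m' i = n i + 2 * m i + (ε i : ℕ))
    (x : RSpace d) : x ∈ G.cube (s + 1, m') ↔ G.chart (s, m) x ∈ unitChild ε := by
  rw [mem_unitChild_iff]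
  refine forall_congr' fun i => ?_
  have hs := CubeIndex.side_pos ((s + 1, m') : CubeIndex d)
  have h1 := side_succ s m m'
  have h2 : G.corner (s + 1, m') i = G.corner (s, m) i +
      CubeIndex.side ((s + 1, m') : CubeIndex d) * ((ε i : ℕ) : ℝ) := by
    have h4 := hn i
    change _ = CubeIndex.side ((s + 1, m') : CubeIndex d) * _ at h4
    change G.offset (s + 1) i + CubeIndex.side ((s + 1, m') : CubeIndex d) * (m' i : ℝ) =
      G.offset s i + CubeIndex.side ((s, m) : CubeIndex d) * (m i : ℝ) + _
    rw [h i, h1]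
    push_cast
    linear_combination -h4
  rw [chart_apply, le_div_iff₀ (h1 ▸ by positivity), div_lt_iff₀ (h1 ▸ by positivity), h1, h2]
  constructor <;> rintro ⟨h1, h2⟩ <;> constructor <;> linarith

lemma exists_parent (G : DyadicGrid d) (s : ℤ) (m' : Fin d → ℤ) :
    ∃ (m : Fin d → ℤ) (ε : Fin d → Fin 2),
      ∀ x, x ∈ G.cube (s + 1, m') ↔ G.chart (s, m) x ∈ unitChild ε := by
  obtain ⟨n, hn⟩ := G.nested s
  refine ⟨fun i => (m' i - n i) / 2, fun i => ⟨((m' i - n i) % 2).toNat, by omega⟩,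
    G.mem_child_iff hn fun i => ?_⟩
  have := Int.toNat_of_nonneg (Int.emod_nonneg (m' i - n i) two_ne_zero)
  simp only [this]
  omega

lemma unitChild_subset (ε : Fin d → Fin 2) : unitChild ε ⊆ unitCube d := by
  intro x hx
  rw [mem_unitChild_iff] at hx
  rw [mem_unitCube_iff]
  intro i
  obtain ⟨h1, h2⟩ := hx i
  have h3 : ((ε i : ℕ) : ℝ) ≤ 1 := by exact_mod_cast Nat.lt_succ_iff.1 (ε i).2
  have h4 : (0 : ℝ) ≤ ((ε i : ℕ) : ℝ) := by positivity
  constructor <;> linarith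

lemma disjoint_unitChild {ε ε' : Fin d → Fin 2} (h : ε ≠ ε') :
    Disjoint (unitChild ε) (unitChild ε') := by
  refine Set.disjoint_left.2 fun x hx hx' => h (funext fun i => ?_)
  obtain ⟨h1, h2⟩ := mem_unitChild_iff.1 hx i
  obtain ⟨h3, h4⟩ := mem_unitChild_iff.1 hx' i
  have h5 : ((ε i : ℕ) : ℝ) < ((ε' i : ℕ) : ℝ) + 1 := by linarith
  have h6 : ((ε' i : ℕ) : ℝ) < ((ε i : ℕ) : ℝ) + 1 := by linarith
  norm_cast at h5 h6
  ext
  omega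

lemma exists_mem_unitChild {x : RSpace d} (hx : x ∈ unitCube d) : ∃ ε, x ∈ unitChild ε := by
  rw [mem_unitCube_iff] at hx
  refine ⟨fun i => if x i < 1 / 2 then 0 else 1, mem_unitChild_iff.2 fun i => ?_⟩
  obtain ⟨h1, h2⟩ := hx i
  split_ifs with h
  · norm_num; exact ⟨h1, by linarith⟩
  · norm_num; exact ⟨by linarith, h2⟩

lemma exists_ancestor (G : DyadicGrid d) (s : ℤ) (n : ℕ) (m' : Fin d → ℤ) :
    ∃ m, G.cube (s + n, m') ⊆ G.cube (s, m) := by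
  induction n generalizing m' with
  | zero => exact ⟨m', by simp⟩
  | succ n ih =>
    obtain ⟨m₁, ε, h1⟩ := G.exists_parent (s + n) m'
    obtain ⟨m, hm⟩ := ih m₁
    refine ⟨m, fun x hx => hm ?_⟩
    rw [Nat.cast_succ, ← add_assoc, h1] at hx
    exact (G.mem_cube_iff _ _).2 (unitChild_subset ε hx)

end DyadicGrid

/-! ### Polynomial functions and the Alpert space. -/

/-- The polynomial functions of degree at most `n`. -/
def polyFun (d n : ℕ) : Submodule ℝ (RSpace d → ℝ) :=
  Submodule.span ℝ (monom '' {β : Fin d → ℕ | ∑ i, β i ≤ n})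

lemma finiteDimensional_polyFun (d n : ℕ) : FiniteDimensional ℝ (polyFun d n) := by
  refine FiniteDimensional.span_of_finite ℝ (Set.Finite.image _ ?_)
  refine (Set.finite_Iic (fun _ : Fin d => n)).subset fun β hβ i => ?_
  exact (Finset.single_le_sum (fun _ _ => Nat.zero_le _) (Finset.mem_univ i)).trans hβ

/-- A span of monomials suits the moment conditions, which then extend by linearity; `MvPolynomial`
suits degree counts, affine substitution and the form of `alpertSpace`. -/
lemma mem_polyFun_iff {d n : ℕ} {q : RSpace d → ℝ} : q ∈ polyFun d n ↔
    ∃ P : MvPolynomial (Fin d) ℝ, P.totalDegree ≤ n ∧ q = fun x => MvPolynomial.eval (x ·) P := by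
  constructor
  · intro hq
    induction hq using Submodule.span_induction with
    | mem q hq =>
      obtain ⟨β, hβ, rfl⟩ := hq
      refine ⟨∏ i, MvPolynomial.X i ^ β i, ?_, ?_⟩
      · refine (MvPolynomial.totalDegree_finsetProd _ _).trans (le_trans ?_ hβ)
        exact Finset.sum_le_sum fun i _ => by rw [MvPolynomial.totalDegree_X_pow]
      · ext x; simp [monom]
    | zero => exact ⟨0, by simp, by ext; simp⟩
    | add f g _ _ hf hg =>
      obtain ⟨P, hP, rfl⟩ := hf
      obtain ⟨Q, hQ, rfl⟩ := hg
      exact ⟨P + Q, (MvPolynomial.totalDegree_add _ _).trans (max_le hP hQ), by ext; simp⟩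
    | smul c f _ hf =>
      obtain ⟨P, hP, rfl⟩ := hf
      exact ⟨c • P, (MvPolynomial.totalDegree_smul_le _ _).trans hP, by ext; simp⟩
  · rintro ⟨P, hP, rfl⟩
    have : (fun x : RSpace d => MvPolynomial.eval (x ·) P) =
        ∑ β ∈ P.support, P.coeff β • monom (β : Fin d → ℕ) := by
      ext x
      simp [MvPolynomial.eval_eq', monom]
    rw [this]
    refine Submodule.sum_mem _ fun β hβ => Submodule.smul_mem _ _ (Submodule.subset_span ?_)
    refine ⟨β, ?_, rfl⟩
    have h := (MvPolynomial.le_totalDegree hβ).trans hP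
    rwa [Finsupp.sum_fintype _ _ fun _ => rfl] at h

lemma one_mem_polyFun (d n : ℕ) : (fun _ => 1 : RSpace d → ℝ) ∈ polyFun d n :=
  mem_polyFun_iff.2 ⟨1, by simp, by ext; simp⟩

lemma polyFun_comp_affine {d n : ℕ} {q : RSpace d → ℝ} (hq : q ∈ polyFun d n) (r : ℝ)
    (b : RSpace d) : (fun x => q (r • x + b)) ∈ polyFun d n := by
  obtain ⟨P, hP, rfl⟩ := mem_polyFun_iff.1 hq
  refine mem_polyFun_iff.2 ⟨P.support.sum fun β => MvPolynomial.C (P.coeff β) *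
    ∏ i, (MvPolynomial.C r * MvPolynomial.X i + MvPolynomial.C (b i)) ^ β i, ?_, ?_⟩
  · refine MvPolynomial.totalDegree_finsetSum_le fun β hβ => ?_
    refine (MvPolynomial.totalDegree_mul _ _).trans ?_
    rw [MvPolynomial.totalDegree_C, zero_add]
    refine (MvPolynomial.totalDegree_finsetProd _ _).trans ?_
    have h := (MvPolynomial.le_totalDegree hβ).trans hP
    rw [Finsupp.sum_fintype _ _ fun _ => rfl] at h
    refine (Finset.sum_le_sum fun i _ => ?_).trans h
    refine (MvPolynomial.totalDegree_pow _ _).trans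
      ((Nat.mul_le_mul_left _ ?_).trans (mul_one _).le)
    refine (MvPolynomial.totalDegree_add _ _).trans (max_le ?_ (by simp))
    exact (MvPolynomial.totalDegree_mul _ _).trans (by simp)
  · ext x
    simp only
    rw [MvPolynomial.eval_eq' _ P]
    simp

lemma continuous_of_mem_polyFun {d n : ℕ} {q : RSpace d → ℝ} (hq : q ∈ polyFun d n) :
    Continuous q := by
  obtain ⟨P, -, rfl⟩ := mem_polyFun_iff.1 hq
  exact continuous_evalPoly P

lemma contDiff_of_mem_polyFun {d n : ℕ} {q : RSpace d → ℝ} (hq : q ∈ polyFun d n) :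
    ContDiff ℝ 1 q := by
  induction hq using Submodule.span_induction with
  | mem q hq =>
    obtain ⟨β, -, rfl⟩ := hq
    unfold monom
    fun_prop
  | zero => exact contDiff_const
  | add f g _ _ hf hg => exact hf.add hg
  | smul c f _ hf => exact contDiff_const.smul hf

lemma exists_bound_of_mem_polyFun {d n : ℕ} {q : RSpace d → ℝ} (hq : q ∈ polyFun d n) :
    ∃ C, 0 ≤ C ∧ ∀ x ∈ unitCube d, |q x| ≤ C := by
  obtain ⟨C, hC⟩ := (isBounded_halfOpenCube (0 : RSpace d) 1).isCompact_closure
    |>.exists_bound_of_continuousOn (continuous_of_mem_polyFun hq).continuousOn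
  exact ⟨max C 0, le_max_right _ _, fun x hx => (hC x (subset_closure hx)).trans (le_max_left _ _)⟩

lemma integrableOn_unitCube {d : ℕ} {f : RSpace d → ℝ} (hf : Measurable f) {C : ℝ}
    (hC : ∀ x ∈ unitCube d, |f x| ≤ C) : IntegrableOn f (unitCube d) := by
  refine Measure.integrableOn_of_bounded (M := C)
    (isBounded_halfOpenCube _ _).measure_lt_top.ne hf.aestronglyMeasurable ?_
  exact (ae_restrict_iff' (measurableSet_halfOpenCube _ _)).2 (Filter.Eventually.of_forall hC)

section AlpertSpace

variable {d κ : ℕ} {f : RSpace d → ℝ}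

lemma alpertSpace_eq_zero (hf : f ∈ alpertSpace d κ) {x : RSpace d} (hx : x ∉ unitCube d) :
    f x = 0 := by
  obtain ⟨⟨P, -, rfl⟩, -⟩ := hf
  exact Finset.sum_eq_zero fun ε _ => Set.indicator_of_notMem
    (fun h => hx (DyadicGrid.unitChild_subset ε h)) _

lemma sum_indicator_unitChild (q : (Fin d → Fin 2) → RSpace d → ℝ) {ε : Fin d → Fin 2}
    {x : RSpace d} (hx : x ∈ unitChild ε) : ∑ ε', (unitChild ε').indicator (q ε') x = q ε x := by
  rw [Finset.sum_eq_single ε, Set.indicator_of_mem hx]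
  · exact fun ε' _ h => Set.indicator_of_notMem
      (fun h' => Set.disjoint_left.1 (DyadicGrid.disjoint_unitChild h) h' hx) _
  · simp

lemma alpertSpace_eqOn (hκ : 0 < κ) (hf : f ∈ alpertSpace d κ) (ε : Fin d → Fin 2) :
    ∃ q ∈ polyFun d (κ - 1), Set.EqOn f q (unitChild ε) := by
  obtain ⟨⟨P, hP, rfl⟩, -⟩ := hf
  refine ⟨_, mem_polyFun_iff.2 ⟨P ε, by have := hP ε; omega, rfl⟩, fun x hx => ?_⟩
  exact sum_indicator_unitChild (fun ε y => MvPolynomial.eval (y ·) (P ε)) hx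

lemma setIntegral_alpertSpace_mul (hκ : 0 < κ) (hf : f ∈ alpertSpace d κ) {q : RSpace d → ℝ}
    (hq : q ∈ polyFun d (κ - 1)) : ∫ x in unitCube d, f x * q x = 0 := by
  obtain ⟨hm, ⟨C, hC⟩, -⟩ := alpertSpace_nice hf
  have hint : ∀ q ∈ polyFun d (κ - 1), IntegrableOn (fun x => f x * q x) (unitCube d) := by
    intro q hq
    obtain ⟨D, hD0, hD⟩ := exists_bound_of_mem_polyFun hq
    refine integrableOn_unitCube (C := C * D)
      (hm.mul (continuous_of_mem_polyFun hq).measurable) fun x hx => ?_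
    rw [abs_mul]
    exact mul_le_mul (hC x) (hD x hx) (abs_nonneg _) ((abs_nonneg _).trans (hC x))
  induction hq using Submodule.span_induction with
  | mem q hq =>
    obtain ⟨β, hβ, rfl⟩ := hq
    exact hf.2 β (by have : ∑ i, β i ≤ κ - 1 := hβ; omega)
  | zero => simp
  | add f g hf' hg' hf hg =>
    simp only [Pi.add_apply, mul_add]
    rw [integral_add (hint _ hf') (hint _ hg'), hf, hg, add_zero]
  | smul c f _ hf =>
    simp only [Pi.smul_apply, smul_eq_mul, mul_left_comm _ c]
    rw [integral_const_mul, hf, mul_zero]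

lemma mem_alpertSpace_of (hκ : 0 < κ) (q : (Fin d → Fin 2) → RSpace d → ℝ)
    (hq : ∀ ε, q ε ∈ polyFun d (κ - 1))
    (h : ∀ r ∈ polyFun d (κ - 1),
      ∫ x in unitCube d, (∑ ε, (unitChild ε).indicator (q ε) x) * r x = 0) :
    (fun x => ∑ ε, (unitChild ε).indicator (q ε) x) ∈ alpertSpace d κ := by
  choose P hP hPq using fun ε => mem_polyFun_iff.1 (hq ε)
  refine ⟨⟨P, fun ε => by have := hP ε; omega, ?_⟩, fun β hβ =>
    h _ (Submodule.subset_span ⟨β, by change ∑ i, β i ≤ κ - 1; omega, rfl⟩)⟩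
  simp_rw [hPq]

end AlpertSpace

lemma integral_comp_chart {d : ℕ} {E : Type*} [NormedAddCommGroup E] [NormedSpace ℝ E]
    (G : DyadicGrid d) (I : CubeIndex d) (F : RSpace d → E) :
    ∫ x, F (G.chart I x) = CubeIndex.side I ^ d • ∫ x, F x := by
  have h := CubeIndex.side_pos I
  unfold DyadicGrid.chart
  rw [integral_sub_right_eq_self (fun x => F ((CubeIndex.side I)⁻¹ • x)),
    Measure.integral_comp_inv_smul, finrank_euclideanSpace, Fintype.card_fin,
    abs_of_pos (by positivity)]

/-! ### Orthonormality of the wavelets. -/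

namespace AlpertBasis

variable {d κ N : ℕ} (w : AlpertBasis d κ N) (G : DyadicGrid d)

lemma wavelet_eq (I : CubeIndex d) (a : Fin N) (x : RSpace d) :
    w.wavelet G I a x = (√(CubeIndex.side I ^ d))⁻¹ * w.h a (G.chart I x) := rfl

lemma wavelet_eq_zero {I : CubeIndex d} {x : RSpace d} (hx : x ∉ G.cube I) (a : Fin N) :
    w.wavelet G I a x = 0 := by
  rw [wavelet_eq, alpertSpace_eq_zero (w.mem a) (fun h => hx ((G.mem_cube_iff I x).2 h)), mul_zero]

/-- The vanishing moments in the coordinates of `I`. What `F` does outside the cube is irrelevant,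
since the wavelet vanishes there. -/
lemma integral_mul_wavelet_eq_zero (hκ : 0 < κ) (I : CubeIndex d) (a : Fin N)
    {F q : RSpace d → ℝ} (hq : q ∈ polyFun d (κ - 1))
    (hF : ∀ x ∈ G.cube I, F x = q (G.chart I x)) : ∫ x, F x * w.wavelet G I a x = 0 := by
  have h1 : (fun x => F x * w.wavelet G I a x) = fun x =>
      (fun y => (√(CubeIndex.side I ^ d))⁻¹ * (w.h a y * q y)) (G.chart I x) := by
    ext x
    by_cases hx : x ∈ G.cube I
    · rw [hF x hx, wavelet_eq]
      ring
    · rw [w.wavelet_eq_zero G hx, mul_zero]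
      simp only
      rw [alpertSpace_eq_zero (w.mem a) (fun h => hx ((G.mem_cube_iff I x).2 h))]
      ring
  have h2 : ∫ y, w.h a y * q y = 0 := by
    rw [← setIntegral_alpertSpace_mul hκ (w.mem a) hq]
    refine (setIntegral_eq_integral_of_forall_compl_eq_zero fun x hx => ?_).symm
    rw [alpertSpace_eq_zero (w.mem a) hx, zero_mul]
  rw [h1, integral_comp_chart G I (fun y => (√(CubeIndex.side I ^ d))⁻¹ * (w.h a y * q y)),
    integral_const_mul, h2, mul_zero, smul_zero]

lemma chart_eq (I J : CubeIndex d) (x : RSpace d) : G.chart I x =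
    (CubeIndex.side J / CubeIndex.side I) • G.chart J x + G.chart I (G.corner J) := by
  have hI := (CubeIndex.side_pos I).ne'
  have hJ := (CubeIndex.side_pos J).ne'
  ext i
  simp only [PiLp.add_apply, PiLp.smul_apply, smul_eq_mul, DyadicGrid.chart_apply]
  field_simp
  ring

/-- A strictly finer cube lies in a single child of a cube of level `s`, and on that child the
wavelet is a polynomial or zero. Together with the vanishing moments of the finer wavelet this gives
orthogonality across scales. -/
lemma wavelet_eqOn (hκ : 0 < κ) {s t : ℤ} (hst : s < t) (m m' : Fin d → ℤ) (a : Fin N) :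
    ∃ q ∈ polyFun d (κ - 1), ∀ x ∈ G.cube (t, m'),
      w.wavelet G (s, m) a x = q (G.chart (t, m') x) := by
  obtain ⟨n, rfl⟩ := Int.le.dest (show s + 1 ≤ t by omega)
  obtain ⟨m₁, h1⟩ := G.exists_ancestor (s + 1) n m'
  obtain ⟨m₂, ε, h2⟩ := G.exists_parent s m₁
  by_cases hm : m₂ = m
  · subst hm
    obtain ⟨q, hq, hqe⟩ := alpertSpace_eqOn hκ (w.mem a) ε
    refine ⟨_, Submodule.smul_mem _ (√(CubeIndex.side (s, m₂) ^ d))⁻¹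
      (polyFun_comp_affine hq (CubeIndex.side ((s + 1 + n, m') : CubeIndex d) /
        CubeIndex.side ((s, m₂) : CubeIndex d))
        (G.chart (s, m₂) (G.corner (s + 1 + n, m')))), fun x hx => ?_⟩
    rw [wavelet_eq, hqe ((h2 x).1 (h1 hx)), chart_eq G (s, m₂) (s + 1 + n, m') x]
    rfl
  · refine ⟨0, zero_mem _, fun x hx => w.wavelet_eq_zero G (fun hx' => ?_) a⟩
    refine Set.disjoint_left.1 (G.disjoint_cube s hm) ?_ hx'
    exact (G.mem_cube_iff _ _).2 (DyadicGrid.unitChild_subset ε ((h2 x).1 (h1 hx)))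

lemma integral_wavelet_mul_wavelet (hκ : 0 < κ) (j k : CubeIndex d × Fin N) :
    ∫ x, w.wavelet G j.1 j.2 x * w.wavelet G k.1 k.2 x = if j = k then 1 else 0 := by
  obtain ⟨⟨s, m⟩, a⟩ := j
  obtain ⟨⟨t, m'⟩, b⟩ := k
  rcases lt_trichotomy s t with hst | rfl | hst
  · rw [if_neg (by simp [hst.ne])]
    obtain ⟨q, hq, h⟩ := w.wavelet_eqOn G hκ hst m m' a
    exact w.integral_mul_wavelet_eq_zero G hκ _ b hq h
  · by_cases hm : m = m'
    · subst hm
      have h : ∀ x, w.wavelet G (s, m) a x * w.wavelet G (s, m) b x =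
          (fun y => (CubeIndex.side ((s, m) : CubeIndex d) ^ d)⁻¹ * (w.h a y * w.h b y))
            (G.chart (s, m) x) := by
        intro x
        have := CubeIndex.side_pos ((s, m) : CubeIndex d)
        simp only [wavelet_eq]
        rw [mul_mul_mul_comm, ← mul_inv, Real.mul_self_sqrt (by positivity)]
      simp_rw [h]
      have := CubeIndex.side_pos ((s, m) : CubeIndex d)
      rw [integral_comp_chart G (s, m)
        (fun y => (CubeIndex.side ((s, m) : CubeIndex d) ^ d)⁻¹ * (w.h a y * w.h b y)),
        integral_const_mul, w.orthonormal, smul_eq_mul, mul_inv_cancel_left₀ (by positivity)]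
      simp
    · rw [if_neg (by simp [hm])]
      refine integral_eq_zero_of_ae (Filter.Eventually.of_forall fun x => ?_)
      by_cases hx : x ∈ G.cube (s, m)
      · simp [w.wavelet_eq_zero G (Set.disjoint_left.1 (G.disjoint_cube s hm) hx)]
      · simp [w.wavelet_eq_zero G hx]
  · rw [if_neg (by simp [hst.ne'])]
    obtain ⟨q, hq, h⟩ := w.wavelet_eqOn G hκ hst m' m b
    simp_rw [mul_comm (w.wavelet G (s, m) a _)]
    exact w.integral_mul_wavelet_eq_zero G hκ _ a hq h

end AlpertBasis

/-! ### Biorthogonality and projections on L^p. -/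

section Pairing

variable {d : ℕ} {𝕜 : Type*} [RCLike 𝕜] {p : ℝ≥0∞} [Fact (1 ≤ p)]

/-- Hölder's inequality with the conjugate exponent. Continuity is what lets the pairing pass
through the series for `Sstar`. -/
lemma exists_pairingCLM {g : RSpace d → ℝ}
    (hg : ∀ q : ℝ≥0∞, MemLp (fun x => (g x : 𝕜)) q (volume : Measure (RSpace d))) :
    ∃ Λ : Lp 𝕜 p (volume : Measure (RSpace d)) →L[𝕜] 𝕜, ∀ f, Λ f = pairing f g := by
  have hpq : p.HolderConjugate (ENNReal.conjExponent p) :=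
    ENNReal.HolderConjugate.conjExponent Fact.out
  have : Fact (1 ≤ ENNReal.conjExponent p) := ⟨hpq.symm.one_le⟩
  refine ⟨((ContinuousLinearMap.mul 𝕜 𝕜).lpPairing volume p
    (ENNReal.conjExponent p)).flip ((hg _).toLp _), fun f => ?_⟩
  rw [ContinuousLinearMap.flip_apply, ContinuousLinearMap.lpPairing_eq_integral]
  refine integral_congr_ae ?_
  filter_upwards [(hg (ENNReal.conjExponent p)).coeFn_toLp] with x hx
  rw [hx]
  rfl

end Pairing

namespace SmoothAlpert

variable {d κ N : ℕ} {Φ : AlpertMollifier d κ} (A : SmoothAlpert Φ N)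
variable {𝕜 : Type*} [RCLike 𝕜] {p : ℝ≥0∞}

lemma pairing_hLp (hκ : 0 < κ) (j k : CubeIndex d × Fin N) :
    pairing (A.hLp 𝕜 p j) (A.h k) = if j = k then 1 else 0 := by
  have h : ∫ x, ((A.h j x * A.h k x : ℝ) : 𝕜) = ((if j = k then 1 else 0 : ℝ) : 𝕜) := by
    rw [← A.w.integral_wavelet_mul_wavelet A.G hκ j k]
    exact integral_ofReal
  rw [show (if j = k then 1 else 0 : 𝕜) = ((if j = k then 1 else 0 : ℝ) : 𝕜) by
    split_ifs <;> simp, ← h]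
  refine integral_congr_ae ?_
  filter_upwards [(A.w.memLp_wavelet A.G 𝕜 p j.1 j.2).coeFn_toLp] with x hx
  rw [show (A.hLp 𝕜 p j : RSpace d → 𝕜) x = (A.h j x : 𝕜) from hx]
  push_cast
  rfl

variable [Fact (1 ≤ p)]

/-- By orthonormality the series has one nonzero term, so no convergence is needed. -/
lemma S_hLp (hκ : 0 < κ) (j : CubeIndex d × Fin N) : A.S (A.hLp 𝕜 p j) = A.hηLp 𝕜 p j := by
  unfold S termS
  simp_rw [A.pairing_hLp hκ]
  rw [tsum_eq_single j fun k hk => by simp [hk.symm]]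
  simp

lemma pairing_Sstar (hκ : 0 < κ) {f : Lp 𝕜 p (volume : Measure (RSpace d))}
    (hf : Summable (A.termSstar f)) (k : CubeIndex d × Fin N) :
    pairing (A.Sstar f) (A.h k) = pairing f (A.hη k) := by
  obtain ⟨Λ, hΛ⟩ := exists_pairingCLM (p := p) fun q => A.w.memLp_wavelet A.G 𝕜 q k.1 k.2
  change ∀ f, Λ f = pairing f (A.h k) at hΛ
  rw [← hΛ, Sstar, Λ.map_tsum hf, tsum_eq_single k fun j hj => ?_]
  · rw [termSstar, map_smul, hΛ, A.pairing_hLp hκ, if_pos rfl, smul_eq_mul, mul_one]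
  · rw [termSstar, map_smul, hΛ, A.pairing_hLp hκ, if_neg hj, smul_zero]

/-- `Function.invFun` agrees with the true inverse because `T` is a composite of bijections; this
makes `Tinv` linear and continuous. -/
lemma exists_Tinv_equiv (h : A.BoundedInvertible 𝕜 p) :
    ∃ eS eSs : Lp 𝕜 p (volume : Measure (RSpace d)) ≃L[𝕜] Lp 𝕜 p (volume : Measure (RSpace d)),
      (∀ f, eS f = A.S f) ∧ (∀ f, eSs f = A.Sstar f) ∧
      ∀ f, A.Tinv f = eSs.symm (eS.symm f) := by
  obtain ⟨-, -, ⟨eS, hS⟩, ⟨eSs, hSs⟩⟩ := h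
  refine ⟨eS, eSs, hS, hSs, fun f => ?_⟩
  have hT : ∀ f, A.T f = eS (eSs f) := fun f => by rw [T, hS, hSs]
  have hinj : Function.Injective (A.T (𝕜 := 𝕜) (p := p)) := fun x y hxy => by
    rw [hT, hT] at hxy
    exact eSs.injective (eS.injective hxy)
  refine hinj ?_
  have h := Function.invFun_eq (f := A.T) (b := f) ⟨eSs.symm (eS.symm f), by simp [hT]⟩
  rw [Tinv, h]
  simp [hT]

lemma pairing_Tinv_hηLp (hκ : 0 < κ) (h : A.BoundedInvertible 𝕜 p)
    (j k : CubeIndex d × Fin N) :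
    pairing (A.Tinv (A.hηLp 𝕜 p j)) (A.hη k) = if j = k then 1 else 0 := by
  obtain ⟨eS, eSs, hS, hSs, hT⟩ := A.exists_Tinv_equiv h
  rw [← A.pairing_Sstar hκ (h.2.1 _), ← hSs, hT, eSs.apply_symm_apply, ← A.S_hLp hκ, ← hS,
    eS.symm_apply_apply, A.pairing_hLp hκ]

lemma isBoundedProjection_pseudoproj (hκ : 0 < κ) (h : A.BoundedInvertible 𝕜 p) (s : ℤ)
    (F : Finset (Fin d → ℤ)) : IsBoundedProjection (A.pseudoproj (𝕜 := 𝕜) (p := p) s F) := by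
  obtain ⟨eS, eSs, hS, hSs, hT⟩ := A.exists_Tinv_equiv h
  choose Λ hΛ using fun k : CubeIndex d × Fin N =>
    exists_pairingCLM (𝕜 := 𝕜) (p := p) fun q =>
      A.w.memLp_smoothWavelet A.G 𝕜 q Φ A.η_pos k.1 k.2
  change ∀ k f, Λ k f = pairing f (A.hη k) at hΛ
  let P : Lp 𝕜 p (volume : Measure (RSpace d)) →L[𝕜] Lp 𝕜 p (volume : Measure (RSpace d)) :=
    ∑ m ∈ F, ∑ a : Fin N, ((Λ ((s, m), a)).comp
      (eSs.symm.toContinuousLinearMap.comp eS.symm.toContinuousLinearMap)).smulRight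
        (A.hηLp 𝕜 p ((s, m), a))
  have hP : ∀ f, P f = A.pseudoproj s F f := by
    intro f
    simp only [P, pseudoproj, sum_apply, ContinuousLinearMap.smulRight_apply,
      ContinuousLinearMap.comp_apply, ← hΛ, hT]
    rfl
  refine ⟨⟨P, hP⟩, fun f => ?_⟩
  -- Biorthogonality leaves a single term of the double sum, with coefficient 1. As the range of `P`
  -- is spanned by these vectors, idempotence follows.
  have hfix : ∀ m ∈ F, ∀ a, P (A.hηLp 𝕜 p ((s, m), a)) = A.hηLp 𝕜 p ((s, m), a) := by
    intro m hm a
    rw [hP, pseudoproj, Finset.sum_eq_single m, Finset.sum_eq_single a]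
    · simp [A.pairing_Tinv_hηLp hκ h]
    · intro b _ hb
      simp [A.pairing_Tinv_hηLp hκ h, hb.symm]
    · simp
    · intro m' _ hm'
      simp [A.pairing_Tinv_hηLp hκ h, hm'.symm]
    · exact fun h => absurd hm h
  rw [← hP (A.pseudoproj s F f), pseudoproj, map_sum]
  refine Finset.sum_congr rfl fun m hm => ?_
  rw [map_sum]
  exact Finset.sum_congr rfl fun a _ => by rw [map_smul, hfix m hm]

end SmoothAlpert

/-! ### Translations on L² and functions of mean zero on cubes. -/

lemma volume_setOf_forall_mem {d : ℕ} (s : Fin d → Set ℝ) (hs : ∀ i, MeasurableSet (s i)) :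
    volume {x : RSpace d | ∀ i, x i ∈ s i} = ∏ i, volume (s i) := by
  have h := (PiLp.volume_preserving_ofLp (Fin d)).measure_preimage
    (MeasurableSet.univ_pi hs).nullMeasurableSet
  rw [volume_pi_pi] at h
  rw [← h]
  congr 1
  ext x
  simp

lemma volume_halfOpenCube {d : ℕ} (c : RSpace d) {ℓ : ℝ} (hℓ : 0 ≤ ℓ) :
    volume (halfOpenCube c ℓ) = ENNReal.ofReal (ℓ ^ d) := by
  have h := volume_setOf_forall_mem (fun i => Set.Ico (c i) (c i + ℓ)) fun i => measurableSet_Ico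
  simp only [Real.volume_Ico, add_sub_cancel_left, Finset.prod_const, Finset.card_univ,
    Fintype.card_fin] at h
  rw [ENNReal.ofReal_pow hℓ, ← h]
  rfl

/-- The space `L²(ℝ^d)`. -/
abbrev L2Space (𝕜 : Type*) [RCLike 𝕜] (d : ℕ) : Type _ := Lp 𝕜 2 (volume : Measure (RSpace d))

section Translation

variable {𝕜 : Type*} [RCLike 𝕜] {d : ℕ}

/-- Translation by `y` on `L²`. -/
noncomputable def lpTranslate (y : RSpace d) : L2Space 𝕜 d →ₗᵢ[𝕜] L2Space 𝕜 d :=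
  Lp.compMeasurePreservingₗᵢ 𝕜 (fun x => x - y) (measurePreserving_sub_right volume y)

lemma coeFn_lpTranslate (y : RSpace d) (f : L2Space 𝕜 d) :
    lpTranslate y f =ᵐ[volume] fun x => f (x - y) :=
  Lp.coeFn_compMeasurePreserving f (measurePreserving_sub_right volume y)

lemma lpTranslate_lpTranslate (y z : RSpace d) (f : L2Space 𝕜 d) :
    lpTranslate y (lpTranslate z f) = lpTranslate (y + z) f := by
  refine Lp.ext ?_
  have h := (measurePreserving_sub_right (volume : Measure (RSpace d)) y).quasiMeasurePreserving.ae
    (coeFn_lpTranslate z f)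
  filter_upwards [coeFn_lpTranslate y (lpTranslate z f), coeFn_lpTranslate (y + z) f, h] with x h1 h2 h3
  rw [h1, h2, h3, sub_sub]

lemma lpTranslate_zero (f : L2Space 𝕜 d) : lpTranslate 0 f = f := by
  refine Lp.ext ?_
  filter_upwards [coeFn_lpTranslate 0 f] with x hx
  rw [hx, sub_zero]

lemma continuous_lpTranslate (f : L2Space 𝕜 d) : Continuous fun y : RSpace d => lpTranslate y f := by
  let g : RSpace d → C(RSpace d, RSpace d) := fun y => ⟨fun x => x - y, by fun_prop⟩
  have hg : Continuous g := ContinuousMap.continuous_of_continuous_uncurry _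
    (by change Continuous fun p : RSpace d × RSpace d => p.2 - p.1; fun_prop)
  exact (continuous_const (y := f)).compMeasurePreservingLp hg
    (fun y => measurePreserving_sub_right volume y) (by simp)

lemma inner_lpTranslate_lpTranslate (y z : RSpace d) (f g : L2Space 𝕜 d) :
    inner 𝕜 (lpTranslate y f) (lpTranslate z g) = inner 𝕜 (lpTranslate (y - z) f) g := by
  rw [← (lpTranslate z).inner_map_map (lpTranslate (y - z) f) g, lpTranslate_lpTranslate,
    add_sub_cancel]

lemma lintegral_enorm_mul_enorm_le (f g : L2Space 𝕜 d) :
    ∫⁻ x, ‖f x‖ₑ * ‖g x‖ₑ ≤ ‖f‖ₑ * ‖g‖ₑ := by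
  have h := ENNReal.lintegral_mul_le_Lp_mul_Lq (volume : Measure (RSpace d))
    Real.HolderConjugate.two_two (Lp.stronglyMeasurable f).enorm.aemeasurable
    (Lp.stronglyMeasurable g).enorm.aemeasurable
  refine h.trans (le_of_eq ?_)
  rw [Lp.enorm_def, Lp.enorm_def, eLpNorm_eq_lintegral_rpow_enorm_toReal (by simp) (by simp),
    eLpNorm_eq_lintegral_rpow_enorm_toReal (by simp) (by simp)]
  simp

end Translation

section Oscillation

variable {𝕜 : Type*} [RCLike 𝕜] {d : ℕ}

lemma enorm_inner_le (a b : 𝕜) : ‖inner 𝕜 a b‖ₑ ≤ ‖a‖ₑ * ‖b‖ₑ := by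
  simp only [enorm_eq_nnnorm]
  exact_mod_cast nnnorm_inner_le_nnnorm (𝕜 := 𝕜) a b

lemma integrableOn_cube (G : DyadicGrid d) (I : CubeIndex d) (f : L2Space 𝕜 d) :
    IntegrableOn f (G.cube I) := by
  have : IsFiniteMeasure ((volume : Measure (RSpace d)).restrict (G.cube I)) :=
    isFiniteMeasure_restrict.2 (isBounded_halfOpenCube _ _).measure_lt_top.ne
  exact ((Lp.memLp f).restrict _).integrable (by norm_num)

lemma measurableSet_setOf_abs_le (ℓ : ℝ) : MeasurableSet {y : RSpace d | ∀ i, |y i| ≤ ℓ} := by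
  simp only [Set.ofPred_forall]
  exact MeasurableSet.iInter fun i => measurableSet_le (by fun_prop) measurable_const

lemma volume_setOf_abs_le {ℓ : ℝ} (hℓ : 0 ≤ ℓ) :
    volume {y : RSpace d | ∀ i, |y i| ≤ ℓ} = ENNReal.ofReal ((2 * ℓ) ^ d) := by
  have h := volume_setOf_forall_mem (fun _ : Fin d => Set.Icc (-ℓ) ℓ) fun i => measurableSet_Icc
  simp only [Real.volume_Icc, Finset.prod_const, Finset.card_univ, Fintype.card_fin, Set.mem_Icc,
    ← abs_le] at h
  rw [h, ENNReal.ofReal_pow (by positivity), two_mul, sub_neg_eq_add]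

/-- As `w` has mean zero on the cube, `H x` may be replaced by `H x - H x'` for any fixed `x'`.
Integrating over `x'` in the cube produces the volume factor on the left, and `x' = x - y` confines
`y` to a box independent of `x`. This turns cancellation of `w` into a statement about translates of
`H`. -/
lemma enorm_setIntegral_inner_le (G : DyadicGrid d) (I : CubeIndex d) (H w : L2Space 𝕜 d)
    (hw : ∫ x in G.cube I, w x = 0) :
    ENNReal.ofReal (CubeIndex.side I ^ d) * ‖∫ x in G.cube I, inner 𝕜 (H x) (w x)‖ₑ ≤
      ∫⁻ x in G.cube I, ∫⁻ y in {y : RSpace d | ∀ i, |y i| ≤ CubeIndex.side I},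
        ‖H (x - y) - H x‖ₑ * ‖w x‖ₑ := by
  have hH : Measurable H := (Lp.stronglyMeasurable H).measurable
  have hwm : Measurable w := (Lp.stronglyMeasurable w).measurable
  have hJ := G.measurableSet_cube I
  have hB := measurableSet_setOf_abs_le (d := d) (CubeIndex.side I)
  have hint : IntegrableOn (fun x => inner 𝕜 (H x) (w x)) (G.cube I) :=
    (L2.integrable_inner H w).integrableOn
  have hwint := integrableOn_cube G I w
  have h1 : ∀ x', ‖∫ x in G.cube I, inner 𝕜 (H x) (w x)‖ₑ ≤
      ∫⁻ x in G.cube I, ‖H x' - H x‖ₑ * ‖w x‖ₑ := by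
    intro x'
    have h2 : ∫ x in G.cube I, inner 𝕜 (H x) (w x) =
        ∫ x in G.cube I, inner 𝕜 (H x - H x') (w x) := by
      simp_rw [inner_sub_left]
      have h3 : IntegrableOn (fun x => inner 𝕜 (H x') (w x)) (G.cube I) :=
        Integrable.const_inner _ hwint
      rw [integral_sub hint h3, integral_inner hwint, hw, inner_zero_right, sub_zero]
    rw [h2]
    refine (enorm_integral_le_lintegral_enorm _).trans (lintegral_mono fun x => ?_)
    rw [← enorm_neg (H x' - H x), neg_sub]
    exact enorm_inner_le _ _
  calc ENNReal.ofReal (CubeIndex.side I ^ d) * ‖∫ x in G.cube I, inner 𝕜 (H x) (w x)‖ₑ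
      = ∫⁻ _ in G.cube I, ‖∫ x in G.cube I, inner 𝕜 (H x) (w x)‖ₑ := by
        rw [setLIntegral_const, mul_comm, DyadicGrid.cube,
          volume_halfOpenCube _ (CubeIndex.side_pos I).le]
    _ ≤ ∫⁻ x' in G.cube I, ∫⁻ x in G.cube I, ‖H x' - H x‖ₑ * ‖w x‖ₑ := lintegral_mono h1
    _ = ∫⁻ x in G.cube I, ∫⁻ x' in G.cube I, ‖H x' - H x‖ₑ * ‖w x‖ₑ := by
        refine lintegral_lintegral_swap (Measurable.aemeasurable ?_)
        exact ((hH.comp measurable_fst).sub (hH.comp measurable_snd)).enorm.mul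
          (hwm.comp measurable_snd).enorm
    _ ≤ _ := by
        refine setLIntegral_mono' hJ fun x hx => ?_
        rw [← lintegral_indicator hJ, ← lintegral_indicator hB, ← lintegral_sub_left_eq_self _ x]
        refine lintegral_mono fun y => ?_
        by_cases hy : x - y ∈ G.cube I
        · rw [Set.indicator_of_mem hy, Set.indicator_of_mem]
          intro i
          have h2 := hx i
          have h3 := hy i
          rw [PiLp.sub_apply] at h3
          exact abs_le.2 ⟨by linarith, by linarith⟩
        · rw [Set.indicator_of_notMem hy]
          exact zero_le

/-- An `L²` function with vanishing integrals over the cubes of side `2^{-s}` pairs badly with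
functions that oscillate little at that scale. -/
lemma norm_inner_le_of_setIntegral_eq_zero (G : DyadicGrid d) (s : ℤ) (H w : L2Space 𝕜 d)
    (hw : ∀ m, ∫ x in G.cube (s, m), w x = 0) {D : ℝ}
    (hD : ∀ y : RSpace d, (∀ i, |y i| ≤ (2 : ℝ) ^ (-s)) → ‖lpTranslate y H - H‖ ≤ D) :
    ‖inner 𝕜 H w‖ ≤ 2 ^ d * D * ‖w‖ := by
  have hH : Measurable H := (Lp.stronglyMeasurable H).measurable
  have hwm : Measurable w := (Lp.stronglyMeasurable w).measurable
  set ℓ : ℝ := (2 : ℝ) ^ (-s) with hℓ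
  have hℓ0 : 0 < ℓ := by positivity
  have hD0 : 0 ≤ D := (norm_nonneg _).trans (hD 0 fun i => by simpa using hℓ0.le)
  set B := {y : RSpace d | ∀ i, |y i| ≤ ℓ} with hBdef
  have hB : MeasurableSet B := measurableSet_setOf_abs_le ℓ
  have hmeas : Measurable (Function.uncurry fun x y : RSpace d =>
      ‖H (x - y) - H x‖ₑ * ‖w x‖ₑ) :=
    ((hH.comp (measurable_fst.sub measurable_snd)).sub (hH.comp measurable_fst)).enorm.mul
      (hwm.comp measurable_fst).enorm
  have hsplit : (inner 𝕜 H w : 𝕜) = ∑' m, ∫ x in G.cube (s, m), inner 𝕜 (H x) (w x) := by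
    rw [L2.inner_def, ← integral_iUnion (fun m => G.measurableSet_cube _)
      (fun m m' h => G.disjoint_cube s h) (L2.integrable_inner H w).integrableOn,
      G.iUnion_cube, setIntegral_univ]
  have key : ENNReal.ofReal (ℓ ^ d) * ‖(inner 𝕜 H w : 𝕜)‖ₑ ≤
      ENNReal.ofReal ((2 * ℓ) ^ d) * (ENNReal.ofReal D * ‖w‖ₑ) := by
    calc ENNReal.ofReal (ℓ ^ d) * ‖(inner 𝕜 H w : 𝕜)‖ₑ
        ≤ ENNReal.ofReal (ℓ ^ d) * ∑' m, ‖∫ x in G.cube (s, m), inner 𝕜 (H x) (w x)‖ₑ := by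
          rw [hsplit]
          gcongr
          exact enorm_tsum_le_tsum_enorm
      _ = ∑' m, ENNReal.ofReal (ℓ ^ d) * ‖∫ x in G.cube (s, m), inner 𝕜 (H x) (w x)‖ₑ :=
          ENNReal.tsum_mul_left.symm
      _ ≤ ∑' m, ∫⁻ x in G.cube (s, m), ∫⁻ y in B, ‖H (x - y) - H x‖ₑ * ‖w x‖ₑ :=
          ENNReal.tsum_le_tsum fun m => enorm_setIntegral_inner_le G (s, m) H w (hw m)
      _ = ∫⁻ x, ∫⁻ y in B, ‖H (x - y) - H x‖ₑ * ‖w x‖ₑ := by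
          rw [← lintegral_iUnion (fun m => G.measurableSet_cube _)
            (fun m m' h => G.disjoint_cube s h), G.iUnion_cube, setLIntegral_univ]
      _ = ∫⁻ y in B, ∫⁻ x, ‖H (x - y) - H x‖ₑ * ‖w x‖ₑ :=
          lintegral_lintegral_swap hmeas.aemeasurable
      -- Cauchy–Schwarz in `x` for each fixed `y`. The box `B` has volume (2ℓ)^d, which against ℓ^d
      -- is the source of the factor 2^d.
      _ ≤ ∫⁻ _ in B, ENNReal.ofReal D * ‖w‖ₑ := by
          refine setLIntegral_mono' hB fun y hy => ?_
          have h1 : ∫⁻ x, ‖H (x - y) - H x‖ₑ * ‖w x‖ₑ =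
              ∫⁻ x, ‖(lpTranslate y H - H : L2Space 𝕜 d) x‖ₑ * ‖w x‖ₑ := by
            refine lintegral_congr_ae ?_
            filter_upwards [Lp.coeFn_sub (lpTranslate y H) H, coeFn_lpTranslate y H] with x h1 h2
            rw [h1, Pi.sub_apply, h2]
          rw [h1]
          refine (lintegral_enorm_mul_enorm_le _ _).trans ?_
          gcongr
          rw [← ofReal_norm]
          exact ENNReal.ofReal_le_ofReal (hD y hy)
      _ = _ := by rw [setLIntegral_const, volume_setOf_abs_le hℓ0.le, mul_comm]
  rw [← ofReal_norm, ← ofReal_norm, ← ENNReal.ofReal_mul (by positivity),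
    ← ENNReal.ofReal_mul hD0, ← ENNReal.ofReal_mul (by positivity),
    ENNReal.ofReal_le_ofReal_iff (by positivity), mul_pow] at key
  refine le_of_mul_le_mul_left (key.trans (le_of_eq ?_)) (pow_pos hℓ0 d)
  ring

end Oscillation

/-! ### L² modulus of continuity of piecewise polynomials. -/

section Modulus

variable {d κ : ℕ}

/-- The part of the box `[-2,2]^d` near the hyperplane `x_i = a`. -/
def slab (i : Fin d) (a r : ℝ) : Set (RSpace d) :=
  {x | ∀ j, x j ∈ if j = i then Set.Icc (a - r) (a + r) else Set.Icc (-2 : ℝ) 2}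

lemma volume_slab (i : Fin d) (a : ℝ) {r : ℝ} (hr : 0 ≤ r) :
    volume (slab i a r) = ENNReal.ofReal (2 * r * 4 ^ (d - 1)) := by
  rw [slab, volume_setOf_forall_mem (fun j => if j = i then Set.Icc (a - r) (a + r) else
    Set.Icc (-2 : ℝ) 2) fun j => by split_ifs <;> exact measurableSet_Icc,
    ← Finset.mul_prod_erase _ _ (Finset.mem_univ i), if_pos rfl]
  have h : ∀ j ∈ Finset.univ.erase i, volume (if j = i then Set.Icc (a - r) (a + r) else
      Set.Icc (-2 : ℝ) 2) = ENNReal.ofReal 4 := by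
    intro j hj
    rw [if_neg (Finset.ne_of_mem_erase hj), Real.volume_Icc]
    norm_num
  rw [Finset.prod_congr rfl h, Finset.prod_const, Finset.card_erase_of_mem (Finset.mem_univ i),
    Finset.card_univ, Fintype.card_fin, Real.volume_Icc, ← ENNReal.ofReal_pow (by norm_num),
    ← ENNReal.ofReal_mul (by linarith)]
  congr 2
  ring

lemma measurableSet_slab (i : Fin d) (a r : ℝ) : MeasurableSet (slab i a r) := by
  simp only [slab, Set.ofPred_forall]
  refine MeasurableSet.iInter fun j => measurableSet_preimage (by fun_prop) ?_
  split_ifs <;> exact measurableSet_Icc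

lemma abs_apply_le_norm (y : RSpace d) (i : Fin d) : |y i| ≤ ‖y‖ := by
  simpa using PiLp.norm_apply_le y i

/-- To enter or leave a child, a translation by `y` must cross one of the hyperplanes x_i = 0, 1/2,
1, and then `x` is within `‖y‖` of that hyperplane. The three values of `a` enumerate them. -/
lemma sub_mem_unitChild_iff {x y : RSpace d} (hx : ∀ i, |x i| ≤ 2)
    (h : ∀ (i : Fin d) (a : Fin 3), x ∉ slab i (a / 2) ‖y‖) (ε : Fin d → Fin 2) :
    x - y ∈ unitChild ε ↔ x ∈ unitChild ε := by
  rw [DyadicGrid.mem_unitChild_iff, DyadicGrid.mem_unitChild_iff]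
  refine forall_congr' fun i => ?_
  have hy := abs_le.1 (abs_apply_le_norm y i)
  have h1 : ∀ a : Fin 3, x i < (a : ℝ) / 2 - ‖y‖ ∨ (a : ℝ) / 2 + ‖y‖ < x i := by
    intro a
    by_contra! hcon
    refine h i a fun j => ?_
    split_ifs with hj
    · subst hj; exact hcon
    · exact abs_le.1 (hx j)
  have h0 := h1 0
  have h1' := h1 1
  have h2 := h1 2
  simp only [PiLp.sub_apply]
  generalize ε i = e
  fin_cases e <;> norm_num at h0 h1' h2 ⊢ <;> constructor <;> rintro ⟨h3, h4⟩ <;> constructor <;>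
    rcases h0 with h0 | h0 <;> rcases h1' with h1' | h1' <;> rcases h2 with h2 | h2 <;> linarith

lemma exists_lipschitz_of_mem_polyFun {n : ℕ} {q : RSpace d → ℝ} (hq : q ∈ polyFun d n) :
    ∃ L, 0 ≤ L ∧ ∀ x ∈ unitCube d, ∀ y ∈ unitCube d, |q x - q y| ≤ L * ‖x - y‖ := by
  obtain ⟨R, hR⟩ := (isBounded_halfOpenCube (0 : RSpace d) 1).subset_closedBall 0
  obtain ⟨K, hK⟩ := ((contDiff_of_mem_polyFun hq).contDiffOn (s := Metric.closedBall 0 R)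
    ).exists_lipschitzOnWith one_ne_zero (convex_closedBall _ _) (isCompact_closedBall _ _)
  refine ⟨K, K.2, fun x hx y hy => ?_⟩
  have := hK.dist_le_mul x (hR hx) y (hR hy)
  rwa [Real.dist_eq, dist_eq_norm] at this

/-- The `L²` modulus of continuity of a function in the Alpert space. -/
lemma exists_integral_sq_sub_le (hκ : 0 < κ) {f : RSpace d → ℝ} (hf : f ∈ alpertSpace d κ) :
    ∃ C, 0 ≤ C ∧ ∀ y : RSpace d, ‖y‖ ≤ 1 → ∫ x, (f (x - y) - f x) ^ 2 ≤ C * ‖y‖ := by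
  choose q hq hfq using alpertSpace_eqOn hκ hf
  choose L hL0 hL using fun ε => exists_lipschitz_of_mem_polyFun (hq ε)
  obtain ⟨M, hM⟩ := (alpertSpace_nice hf).2.1
  set L' := ∑ ε, L ε
  have hL' : ∀ ε, L ε ≤ L' := fun ε =>
    Finset.single_le_sum (fun i _ => hL0 i) (Finset.mem_univ ε)
  have hL'0 : 0 ≤ L' := Finset.sum_nonneg fun i _ => hL0 i
  have hM0 : 0 ≤ M := (abs_nonneg _).trans (hM 0)
  set K : Set (RSpace d) := {x | ∀ i, |x i| ≤ 2} with hK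
  have hKm : MeasurableSet K := measurableSet_setOf_abs_le 2
  have hKv : volume K = ENNReal.ofReal ((2 * 2) ^ d) := volume_setOf_abs_le (by norm_num)
  refine ⟨L' ^ 2 * 4 ^ d + ∑ _i : Fin d, ∑ _a : Fin 3, (2 * M) ^ 2 * (2 * 4 ^ (d - 1)),
    by positivity, fun y hy => ?_⟩
  -- Off the slabs, `x` and `x - y` lie in the same child, where `f` is Lipschitz, or both lie
  -- outside the unit cube. On a slab only the sup bound is available, but slabs have volume O(‖y‖).
  -- The jumps thus limit the squared modulus to first order in `‖y‖`.
  have hpt : ∀ x, (f (x - y) - f x) ^ 2 ≤ K.indicator (fun _ => (L' * ‖y‖) ^ 2) x +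
      ∑ i, ∑ a : Fin 3, (slab i (a / 2) ‖y‖).indicator (fun _ => (2 * M) ^ 2) x := by
    intro x
    have hs0 : 0 ≤ ∑ i, ∑ a : Fin 3, (slab i (a / 2) ‖y‖).indicator (fun _ => (2 * M) ^ 2) x :=
      Finset.sum_nonneg fun i _ => Finset.sum_nonneg fun a _ =>
        Set.indicator_nonneg (fun _ _ => sq_nonneg _) _
    by_cases hxK : x ∈ K
    · by_cases hbad : ∀ (i : Fin d) (a : Fin 3), x ∉ slab i (a / 2) ‖y‖
      · refine le_add_of_le_of_nonneg ?_ hs0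
        rw [Set.indicator_of_mem hxK]
        have hiff := sub_mem_unitChild_iff hxK hbad
        by_cases hx : x ∈ unitCube d
        · obtain ⟨ε, hε⟩ := DyadicGrid.exists_mem_unitChild hx
          have hε' := (hiff ε).2 hε
          rw [hfq ε hε, hfq ε hε', ← sq_abs (q ε (x - y) - q ε x)]
          gcongr
          refine (hL ε _ (DyadicGrid.unitChild_subset ε hε') _ hx).trans ?_
          rw [sub_sub_cancel_left, norm_neg]
          gcongr
          exact hL' ε
        · have hx' : x - y ∉ unitCube d := by
            intro h
            obtain ⟨ε, hε⟩ := DyadicGrid.exists_mem_unitChild h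
            exact hx (DyadicGrid.unitChild_subset ε ((hiff ε).1 hε))
          rw [alpertSpace_eq_zero hf hx, alpertSpace_eq_zero hf hx']
          simp only [sub_zero, ne_eq, OfNat.ofNat_ne_zero, not_false_eq_true, zero_pow]
          positivity
      · push Not at hbad
        obtain ⟨i, a, hia⟩ := hbad
        refine le_add_of_nonneg_of_le (Set.indicator_nonneg (fun _ _ => sq_nonneg _) _) ?_
        have h1 : (f (x - y) - f x) ^ 2 ≤ (2 * M) ^ 2 := by
          rw [← sq_abs (f (x - y) - f x)]
          gcongr
          exact (abs_sub _ _).trans (by linarith [hM x, hM (x - y)])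
        refine (h1.trans (Set.indicator_of_mem hia (fun _ => (2 * M) ^ 2)).ge).trans ?_
        refine (Finset.single_le_sum (f := fun a : Fin 3 =>
          (slab i (a / 2) ‖y‖).indicator (fun _ => (2 * M) ^ 2) x)
          (fun a _ => Set.indicator_nonneg (fun _ _ => sq_nonneg _) _) (Finset.mem_univ a)).trans ?_
        exact Finset.single_le_sum (f := fun i => ∑ a : Fin 3,
          (slab i (a / 2) ‖y‖).indicator (fun _ => (2 * M) ^ 2) x)
          (fun i _ => Finset.sum_nonneg fun a _ =>
            Set.indicator_nonneg (fun _ _ => sq_nonneg _) _) (Finset.mem_univ i)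
    · have hx : x ∉ unitCube d := fun h => hxK fun i => by
        have := DyadicGrid.mem_unitCube_iff.1 h i
        exact abs_le.2 ⟨by linarith, by linarith⟩
      have hx' : x - y ∉ unitCube d := fun h => hxK fun i => by
        have h1 := DyadicGrid.mem_unitCube_iff.1 h i
        have h2 := abs_le.1 ((abs_apply_le_norm y i).trans hy)
        rw [PiLp.sub_apply] at h1
        exact abs_le.2 ⟨by linarith, by linarith⟩
      rw [alpertSpace_eq_zero hf hx, alpertSpace_eq_zero hf hx', Set.indicator_of_notMem hxK]
      simpa using hs0
  have hi1 : Integrable (K.indicator fun _ => (L' * ‖y‖) ^ 2) :=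
    (integrable_indicator_iff hKm).2 (integrableOn_const (by rw [hKv]; exact ENNReal.ofReal_ne_top))
  have hi2 : ∀ (i : Fin d) (a : Fin 3),
      Integrable ((slab i ((a : ℝ) / 2) ‖y‖).indicator fun _ => (2 * M) ^ 2) := fun i a =>
    (integrable_indicator_iff (measurableSet_slab _ _ _)).2
      (integrableOn_const (by rw [volume_slab _ _ (norm_nonneg y)]; exact ENNReal.ofReal_ne_top))
  refine (integral_mono_of_nonneg (Filter.Eventually.of_forall fun x => sq_nonneg _)
    (hi1.add (integrable_finsetSum _ fun i _ => integrable_finsetSum _ fun a _ => hi2 i a))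
    (Filter.Eventually.of_forall hpt)).trans ?_
  simp only [Pi.add_apply]
  rw [integral_add hi1 (integrable_finsetSum _ fun i _ => integrable_finsetSum _ fun a _ =>
    hi2 i a), integral_finsetSum _ fun i _ => integrable_finsetSum _ fun a _ => hi2 i a]
  simp_rw [integral_finsetSum _ fun a _ => hi2 _ a]
  rw [add_mul, Finset.sum_mul (s := (Finset.univ : Finset (Fin d)))]
  refine add_le_add ?_ (Finset.sum_le_sum fun i _ => ?_)
  · rw [integral_indicator hKm, setIntegral_const, measureReal_def, hKv,
      ENNReal.toReal_ofReal (by positivity), smul_eq_mul]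
    have : ‖y‖ ^ 2 ≤ ‖y‖ := by nlinarith [norm_nonneg y]
    calc (2 * 2 : ℝ) ^ d * (L' * ‖y‖) ^ 2 = L' ^ 2 * 4 ^ d * ‖y‖ ^ 2 := by norm_num; ring
      _ ≤ _ := by gcongr
  · rw [Finset.sum_mul]
    refine Finset.sum_le_sum fun a _ => le_of_eq ?_
    rw [integral_indicator (measurableSet_slab _ _ _), setIntegral_const, measureReal_def,
      volume_slab _ _ (norm_nonneg y), ENNReal.toReal_ofReal (by positivity), smul_eq_mul]
    ring

end Modulus

/-! ### Schur's test and inner products in L². -/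

section Schur

variable {𝕜 : Type*} [RCLike 𝕜] {H : Type*} [NormedAddCommGroup H] [InnerProductSpace 𝕜 H]

/-- Schur's test for almost orthogonal vectors. -/
lemma norm_sq_sum_le_of_schur {ι : Type*} (F : Finset ι) (x : ι → H) (u : ι → ℝ)
    (a : ι → ι → ℝ) (ha : ∀ i j, 0 ≤ a i j) (hsymm : ∀ i j, a i j = a j i)
    (hx : ∀ i ∈ F, ∀ j ∈ F, ‖inner 𝕜 (x i) (x j)‖ ≤ a i j * (u i * u j)) {K : ℝ}
    (hK : ∀ i ∈ F, ∑ j ∈ F, a i j ≤ K) : ‖∑ i ∈ F, x i‖ ^ 2 ≤ K * ∑ i ∈ F, u i ^ 2 := by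
  have h1 : ‖∑ i ∈ F, x i‖ ^ 2 ≤ ∑ i ∈ F, ∑ j ∈ F, a i j * (u i * u j) := by
    calc ‖∑ i ∈ F, x i‖ ^ 2 = ‖inner 𝕜 (∑ i ∈ F, x i) (∑ i ∈ F, x i)‖ := by
          rw [inner_self_eq_norm_sq_to_K, norm_pow, RCLike.norm_ofReal, abs_norm]
      _ = ‖∑ i ∈ F, ∑ j ∈ F, inner 𝕜 (x i) (x j)‖ := by
          rw [sum_inner]; simp_rw [inner_sum]
      _ ≤ ∑ i ∈ F, ∑ j ∈ F, ‖inner 𝕜 (x i) (x j)‖ :=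
          (norm_sum_le _ _).trans (Finset.sum_le_sum fun i _ => norm_sum_le _ _)
      _ ≤ _ := Finset.sum_le_sum fun i hi => Finset.sum_le_sum fun j hj => hx i hi j hj
  -- The inequality 2 u_i u_j ≤ u_i² + u_j²; by symmetry of `a` both halves then reduce to row sums.
  have h2 : ∑ i ∈ F, ∑ j ∈ F, a i j * (u i * u j) ≤
      ∑ i ∈ F, ∑ j ∈ F, (a i j * u i ^ 2 / 2 + a j i * u j ^ 2 / 2) := by
    refine Finset.sum_le_sum fun i _ => Finset.sum_le_sum fun j _ => ?_
    rw [← hsymm i j]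
    nlinarith [mul_nonneg (ha i j) (sq_nonneg (u i - u j))]
  have h3 : ∑ i ∈ F, ∑ j ∈ F, (a i j * u i ^ 2 / 2 + a j i * u j ^ 2 / 2) =
      ∑ i ∈ F, u i ^ 2 * ∑ j ∈ F, a i j := by
    simp_rw [Finset.sum_add_distrib]
    rw [Finset.sum_comm (f := fun i j => a j i * u j ^ 2 / 2), ← Finset.sum_add_distrib]
    refine Finset.sum_congr rfl fun i _ => ?_
    rw [Finset.mul_sum, ← Finset.sum_add_distrib]
    exact Finset.sum_congr rfl fun j _ => by ring
  refine h1.trans (h2.trans (h3.le.trans ?_))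
  rw [Finset.mul_sum]
  refine Finset.sum_le_sum fun i hi => ?_
  rw [mul_comm]
  exact mul_le_mul_of_nonneg_right (hK i hi) (sq_nonneg _)

end Schur

section

variable {𝕜 : Type*} [RCLike 𝕜] {d : ℕ}

lemma norm_sq_eq_integral (f : L2Space 𝕜 d) : ‖f‖ ^ 2 = ∫ x, ‖f x‖ ^ 2 := by
  have h := inner_self_eq_norm_sq_to_K (𝕜 := 𝕜) f
  rw [L2.inner_def] at h
  simp_rw [inner_self_eq_norm_sq_to_K] at h
  have h2 : ∫ x, ((‖f x‖ : 𝕜)) ^ 2 = ((∫ x, ‖f x‖ ^ 2 : ℝ) : 𝕜) := by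
    rw [← integral_ofReal]
    push_cast
    rfl
  rw [h2] at h
  exact_mod_cast h.symm

lemma inner_eq_zero_of_disjoint {f g : L2Space 𝕜 d} {X Y : Set (RSpace d)} (hXY : Disjoint X Y)
    (hf : ∀ᵐ x, x ∉ X → f x = 0) (hg : ∀ᵐ x, x ∉ Y → g x = 0) : inner 𝕜 f g = 0 := by
  rw [L2.inner_def]
  refine integral_eq_zero_of_ae ?_
  filter_upwards [hf, hg] with x h1 h2
  by_cases hx : x ∈ X
  · rw [h2 (Set.disjoint_left.1 hXY hx), inner_zero_right]; rfl
  · rw [h1 hx, inner_zero_left]; rfl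

end

/-! ### Modulus of continuity of wavelet sums at one scale. -/

namespace SmoothAlpert

variable {d κ N : ℕ} {Φ : AlpertMollifier d κ} (A : SmoothAlpert Φ N)
variable (𝕜 : Type*) [RCLike 𝕜]

lemma coeFn_hLp (k : CubeIndex d × Fin N) :
    A.hLp 𝕜 2 k =ᵐ[volume] fun x => (A.h k x : 𝕜) :=
  (A.w.memLp_wavelet A.G 𝕜 2 k.1 k.2).coeFn_toLp

lemma coeFn_hηLp (k : CubeIndex d × Fin N) :
    A.hηLp 𝕜 2 k =ᵐ[volume] fun x => (A.hη k x : 𝕜) :=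
  (A.w.memLp_smoothWavelet A.G 𝕜 2 Φ A.η_pos k.1 k.2).coeFn_toLp

variable {𝕜}

lemma inner_eq_pairing {g : RSpace d → ℝ} {G f : L2Space 𝕜 d}
    (hG : G =ᵐ[volume] fun x => (g x : 𝕜)) : inner 𝕜 G f = pairing f g := by
  rw [L2.inner_def]
  refine integral_congr_ae ?_
  filter_upwards [hG] with x hx
  rw [hx, RCLike.inner_apply, RCLike.conj_ofReal]

variable (𝕜)

lemma orthonormal_hLp (hκ : 0 < κ) : Orthonormal 𝕜 (A.hLp 𝕜 2) := by
  rw [orthonormal_iff_ite]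
  intro j k
  rw [inner_eq_pairing (A.coeFn_hLp 𝕜 j), A.pairing_hLp hκ]
  simp [eq_comm]

/-- The span of the wavelets of a cube. -/
noncomputable def cubeSpan (I : CubeIndex d) : Submodule 𝕜 (L2Space 𝕜 d) :=
  Submodule.span 𝕜 (Set.range fun a => A.hLp 𝕜 2 (I, a))

variable {𝕜}

lemma ae_eq_zero_of_mem_cubeSpan {I : CubeIndex d} {v : L2Space 𝕜 d} (hv : v ∈ A.cubeSpan 𝕜 I) :
    ∀ᵐ x, x ∉ A.G.cube I → v x = 0 := by
  induction hv using Submodule.span_induction with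
  | mem v hv =>
    obtain ⟨a, rfl⟩ := hv
    filter_upwards [A.coeFn_hLp 𝕜 (I, a)] with x hx hxI
    rw [hx, h, A.w.wavelet_eq_zero A.G hxI, RCLike.ofReal_zero]
  | zero =>
    filter_upwards [Lp.coeFn_zero 𝕜 2 (volume : Measure (RSpace d))] with x hx _
    rw [hx]; rfl
  | add f g _ _ hf hg =>
    filter_upwards [Lp.coeFn_add f g, hf, hg] with x hx h1 h2 h3
    rw [hx, Pi.add_apply, h1 h3, h2 h3, add_zero]
  | smul c f _ hf =>
    filter_upwards [Lp.coeFn_smul c f, hf] with x hx h1 h3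
    rw [hx, Pi.smul_apply, h1 h3, smul_zero]

lemma setIntegral_eq_zero_of_mem_cubeSpan (hκ : 0 < κ) {s : ℤ} {m : Fin d → ℤ} {v : L2Space 𝕜 d}
    (hv : v ∈ A.cubeSpan 𝕜 (s, m)) (m' : Fin d → ℤ) : ∫ x in A.G.cube (s, m'), v x = 0 := by
  induction hv using Submodule.span_induction with
  | mem v hv =>
    obtain ⟨a, rfl⟩ := hv
    have h1 : ∫ x, (A.G.cube (s, m')).indicator 1 x * A.h ((s, m), a) x = 0 := by
      by_cases hm : m' = m
      · subst hm
        refine A.w.integral_mul_wavelet_eq_zero A.G hκ _ a (one_mem_polyFun d _) fun x hx => ?_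
        rw [Set.indicator_of_mem hx, Pi.one_apply]
      · refine integral_eq_zero_of_ae (Filter.Eventually.of_forall fun x => ?_)
        by_cases hx : x ∈ A.G.cube (s, m')
        · simp [h, A.w.wavelet_eq_zero A.G (Set.disjoint_left.1 (A.G.disjoint_cube s hm) hx)]
        · simp [hx]
    rw [setIntegral_congr_ae (A.G.measurableSet_cube _)
      ((A.coeFn_hLp 𝕜 ((s, m), a)).mono fun x hx _ => hx), integral_ofReal,
      ← integral_indicator (A.G.measurableSet_cube _), ← RCLike.ofReal_zero, ← h1]
    congr 2
    ext x
    by_cases hx : x ∈ A.G.cube (s, m') <;> simp [hx]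
  | zero =>
    refine (setIntegral_congr_ae (A.G.measurableSet_cube _)
      ((Lp.coeFn_zero 𝕜 2 (volume : Measure (RSpace d))).mono fun x hx _ => hx)).trans ?_
    simp
  | add f g _ _ hf hg =>
    rw [setIntegral_congr_ae (A.G.measurableSet_cube _)
      ((Lp.coeFn_add f g).mono fun x hx _ => hx)]
    simp only [Pi.add_apply]
    have hif : Integrable f (volume.restrict (A.G.cube (s, m'))) := integrableOn_cube _ _ f
    have hig : Integrable g (volume.restrict (A.G.cube (s, m'))) := integrableOn_cube _ _ g
    rw [integral_add hif hig, hf, hg, add_zero]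
  | smul c f _ hf =>
    rw [setIntegral_congr_ae (A.G.measurableSet_cube _)
      ((Lp.coeFn_smul c f).mono fun x hx _ => hx)]
    simp only [Pi.smul_apply]
    rw [integral_smul, hf, smul_zero]

variable (𝕜)

/-- Rescaling to the unit cube turns `y` into `y / side`, so one constant serves all cubes and
grids. When the rescaled translation is longer than 1, the trivial bound 2 for unit vectors
suffices. -/
lemma exists_norm_lpTranslate_hLp_sub_le (hκ : 0 < κ) (w : AlpertBasis d κ N) :
    ∃ C, 0 ≤ C ∧ ∀ A : SmoothAlpert Φ N, A.w = w → ∀ (k : CubeIndex d × Fin N) (y : RSpace d),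
      ‖lpTranslate y (A.hLp 𝕜 2 k) - A.hLp 𝕜 2 k‖ ≤ C * √(‖y‖ / CubeIndex.side k.1) := by
  choose C hC0 hC using fun a => exists_integral_sq_sub_le hκ (w.mem a)
  set D := ∑ a, C a
  have hD : ∀ a, C a ≤ D := fun a => Finset.single_le_sum (fun i _ => hC0 i) (Finset.mem_univ a)
  have hD0 : 0 ≤ D := Finset.sum_nonneg fun i _ => hC0 i
  refine ⟨max (√D) 2, by positivity, ?_⟩
  rintro A rfl ⟨I, a⟩ y
  have hs := CubeIndex.side_pos I
  set z := (CubeIndex.side I)⁻¹ • y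
  have hz : ‖z‖ = ‖y‖ / CubeIndex.side I := by
    rw [norm_smul, norm_inv, Real.norm_eq_abs, abs_of_pos hs, div_eq_inv_mul]
  simp only
  rw [← hz]
  rcases le_or_gt ‖z‖ 1 with h1 | h1
  · have key : ‖lpTranslate y (A.hLp 𝕜 2 (I, a)) - A.hLp 𝕜 2 (I, a)‖ ^ 2 ≤ C a * ‖z‖ := by
      rw [norm_sq_eq_integral]
      refine le_trans (le_of_eq ?_) (hC a z h1)
      have h2 : ∀ᵐ x, ‖(lpTranslate y (A.hLp 𝕜 2 (I, a)) - A.hLp 𝕜 2 (I, a) : L2Space 𝕜 d) x‖ ^ 2 =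
          (fun t => (CubeIndex.side I ^ d)⁻¹ * (A.w.h a (t - z) - A.w.h a t) ^ 2)
            (A.G.chart I x) := by
        have h3 := (measurePreserving_sub_right (volume : Measure (RSpace d)) y
          ).quasiMeasurePreserving.ae (A.coeFn_hLp 𝕜 (I, a))
        filter_upwards [Lp.coeFn_sub (lpTranslate y (A.hLp 𝕜 2 (I, a))) (A.hLp 𝕜 2 (I, a)),
          coeFn_lpTranslate y (A.hLp 𝕜 2 (I, a)), A.coeFn_hLp 𝕜 (I, a), h3] with x h4 h5 h6 h7
        rw [h4, Pi.sub_apply, h5, h6, h7, ← RCLike.ofReal_sub, RCLike.norm_ofReal, sq_abs]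
        have h8 : A.G.chart I (x - y) = A.G.chart I x - z := by
          simp only [DyadicGrid.chart, z, ← smul_sub]
          congr 1
          abel
        simp only [h, A.w.wavelet_eq, h8]
        rw [← mul_sub, mul_pow, inv_pow, Real.sq_sqrt (by positivity)]
      rw [integral_congr_ae h2, integral_comp_chart A.G I
        (fun t => (CubeIndex.side I ^ d)⁻¹ * (A.w.h a (t - z) - A.w.h a t) ^ 2),
        integral_const_mul, smul_eq_mul, mul_inv_cancel_left₀ (by positivity)]
    calc ‖lpTranslate y (A.hLp 𝕜 2 (I, a)) - A.hLp 𝕜 2 (I, a)‖ ≤ √(C a * ‖z‖) :=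
          Real.le_sqrt_of_sq_le key
      _ ≤ √(D * ‖z‖) := by gcongr; exact hD a
      _ = √D * √‖z‖ := Real.sqrt_mul hD0 _
      _ ≤ _ := by gcongr; exact le_max_left _ _
  · calc ‖lpTranslate y (A.hLp 𝕜 2 (I, a)) - A.hLp 𝕜 2 (I, a)‖
        ≤ ‖lpTranslate y (A.hLp 𝕜 2 (I, a))‖ + ‖A.hLp 𝕜 2 (I, a)‖ := norm_sub_le _ _
      _ = 2 * 1 := by
        rw [LinearIsometry.norm_map, (A.orthonormal_hLp 𝕜 hκ).1]; norm_num
      _ ≤ _ := by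
        gcongr
        · exact le_max_right _ _
        · exact Real.one_le_sqrt.2 h1.le

/-- The span does not depend on the choice of unit basis, nor on its number of elements. Constants
computed from one fixed basis therefore serve every system. -/
lemma cubeSpan_le {N' : ℕ} (B : SmoothAlpert Φ N') (hG : A.G = B.G) (I : CubeIndex d) :
    A.cubeSpan 𝕜 I ≤ B.cubeSpan 𝕜 I := by
  refine Submodule.span_le.2 ?_
  rintro _ ⟨a, rfl⟩
  obtain ⟨c, hc⟩ := (Submodule.mem_span_range_iff_exists_fun ℝ).1 (B.w.spanning _ (A.w.mem a))
  refine (Submodule.mem_span_range_iff_exists_fun 𝕜).2 ⟨fun b => (c b : 𝕜), Lp.ext ?_⟩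
  have h1 : ∀ᵐ x, ∀ b, ((c b : 𝕜) • B.hLp 𝕜 2 (I, b) : L2Space 𝕜 d) x = (c b * B.h (I, b) x : ℝ) := by
    refine ae_all_iff.2 fun b => ?_
    filter_upwards [Lp.coeFn_smul (c b : 𝕜) (B.hLp 𝕜 2 (I, b)), B.coeFn_hLp 𝕜 (I, b)] with x h2 h3
    rw [h2, Pi.smul_apply, h3, smul_eq_mul]
    push_cast
    rfl
  have h2 := Lp.coeFn_finsetSum Finset.univ fun b => (c b : 𝕜) • B.hLp 𝕜 2 (I, b)
  filter_upwards [h1, h2, A.coeFn_hLp 𝕜 (I, a)] with x h1 h2 h3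
  rw [h2, h3]
  simp only [Finset.sum_apply, h1, h, AlpertBasis.wavelet_eq, ← hc, hG]
  push_cast
  simp only [Pi.smul_apply, smul_eq_mul, Finset.mul_sum]
  push_cast
  exact Finset.sum_congr rfl fun b _ => by ring

lemma exists_norm_lpTranslate_sub_le_of_mem_cubeSpan (hκ : 0 < κ) :
    ∃ C, 0 ≤ C ∧ ∀ (N : ℕ) (A : SmoothAlpert Φ N) (I : CubeIndex d), ∀ v ∈ A.cubeSpan 𝕜 I,
      ∀ y : RSpace d, ‖lpTranslate y v - v‖ ≤ C * √(‖y‖ / CubeIndex.side I) * ‖v‖ := by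
  by_cases hne : ∃ N, Nonempty (AlpertBasis d κ N)
  swap
  -- If no basis exists for any `N`, there is no system to bound and any constant works.
  · exact ⟨0, le_rfl, fun N A => absurd ⟨N, ⟨A.w⟩⟩ hne⟩
  obtain ⟨N₀, ⟨w₀⟩⟩ := hne
  obtain ⟨C, hC0, hC⟩ := exists_norm_lpTranslate_hLp_sub_le (Φ := Φ) 𝕜 hκ w₀
  refine ⟨N₀ * C, by positivity, fun N A I v hv y => ?_⟩
  let B : SmoothAlpert Φ N₀ := ⟨w₀, A.η, A.η_pos, A.G⟩
  obtain ⟨c, rfl⟩ := (Submodule.mem_span_range_iff_exists_fun 𝕜).1 (A.cubeSpan_le 𝕜 B rfl I hv)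
  have hon : Orthonormal 𝕜 fun b => B.hLp 𝕜 2 (I, b) :=
    (B.orthonormal_hLp 𝕜 hκ).comp _ fun a b h => (Prod.mk.inj h).2
  set v := ∑ b, c b • B.hLp 𝕜 2 (I, b)
  have hcb : ∀ b, ‖c b‖ ≤ ‖v‖ := fun b => by
    rw [← hon.inner_right_fintype c b]
    exact (norm_inner_le_norm _ _).trans (by rw [hon.1, one_mul])
  calc ‖lpTranslate y v - v‖
      = ‖∑ b, c b • (lpTranslate y (B.hLp 𝕜 2 (I, b)) - B.hLp 𝕜 2 (I, b))‖ := by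
        simp only [v, map_sum, map_smul, smul_sub, Finset.sum_sub_distrib]
    _ ≤ ∑ _b : Fin N₀, ‖v‖ * (C * √(‖y‖ / CubeIndex.side I)) := by
        refine (norm_sum_le _ _).trans (Finset.sum_le_sum fun b _ => ?_)
        rw [norm_smul]
        exact mul_le_mul (hcb b) (hC B rfl (I, b) y) (norm_nonneg _) (norm_nonneg _)
    _ = _ := by
        rw [Finset.sum_const, Finset.card_univ, Fintype.card_fin, nsmul_eq_mul]
        ring

lemma inner_eq_zero_of_mem_cubeSpan {s : ℤ} {m m' : Fin d → ℤ} (h : m ≠ m')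
    {v v' : L2Space 𝕜 d} (hv : v ∈ A.cubeSpan 𝕜 (s, m)) (hv' : v' ∈ A.cubeSpan 𝕜 (s, m')) :
    inner 𝕜 v v' = 0 :=
  inner_eq_zero_of_disjoint (A.G.disjoint_cube s h) (A.ae_eq_zero_of_mem_cubeSpan hv)
    (A.ae_eq_zero_of_mem_cubeSpan hv')

lemma abs_sub_le_one_of_mem_cube (G : DyadicGrid d) {s : ℤ} {m m' : Fin d → ℤ} {x y : RSpace d}
    (hy : ∀ i, |y i| ≤ (2 : ℝ) ^ (-s)) (h : x ∈ G.cube (s, m) ∨ x - y ∈ G.cube (s, m))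
    (h' : x ∈ G.cube (s, m') ∨ x - y ∈ G.cube (s, m')) (i : Fin d) : |m' i - m i| ≤ 1 := by
  have hpos : (0 : ℝ) < (2 : ℝ) ^ (-s) := by positivity
  have hc : ∀ m, G.corner (s, m) i = G.offset s i + (2 : ℝ) ^ (-s) * m i := fun m => rfl
  have hsd : ∀ m : Fin d → ℤ, CubeIndex.side (s, m) = (2 : ℝ) ^ (-s) := fun m => rfl
  have hyi := abs_le.1 (hy i)
  have key : (2 : ℝ) ^ (-s) * (m i - m' i) < (2 : ℝ) ^ (-s) * 2 ∧
      (2 : ℝ) ^ (-s) * (m' i - m i) < (2 : ℝ) ^ (-s) * 2 := by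
    rcases h with h | h <;> rcases h' with h' | h' <;> replace h := h i <;> replace h' := h' i <;>
      simp only [hc, hsd, PiLp.sub_apply] at h h' <;> constructor <;> nlinarith
  have h1 := lt_of_mul_lt_mul_left key.1 hpos.le
  have h2 := lt_of_mul_lt_mul_left key.2 hpos.le
  norm_cast at h1 h2
  rw [abs_le]
  omega

/-- The `L²` modulus of continuity of combinations of wavelets of the same scale. -/
lemma exists_norm_lpTranslate_sum_sub_le (hκ : 0 < κ) :
    ∃ C, 0 ≤ C ∧ ∀ (N : ℕ) (A : SmoothAlpert Φ N) (s : ℤ) (F : Finset (Fin d → ℤ))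
      (v : (Fin d → ℤ) → L2Space 𝕜 d), (∀ m, v m ∈ A.cubeSpan 𝕜 (s, m)) → ∀ y : RSpace d,
      (∀ i, |y i| ≤ (2 : ℝ) ^ (-s)) → ‖lpTranslate y (∑ m ∈ F, v m) - ∑ m ∈ F, v m‖ ≤
        C * √(‖y‖ * (2 : ℝ) ^ s) * ‖∑ m ∈ F, v m‖ := by
  obtain ⟨C, hC0, hC⟩ := exists_norm_lpTranslate_sub_le_of_mem_cubeSpan (Φ := Φ) 𝕜 hκ
  refine ⟨√(3 ^ d) * C, by positivity, fun N A s F v hv y hy => ?_⟩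
  set ρ := √(‖y‖ * (2 : ℝ) ^ s) with hρ
  have hC' : ∀ m, ‖lpTranslate y (v m) - v m‖ ≤ C * ρ * ‖v m‖ := by
    intro m
    have := hC N A (s, m) (v m) (hv m) y
    rwa [CubeIndex.side, zpow_neg, div_inv_eq_mul] at this
  have hsupp : ∀ m, ∀ᵐ x, x ∉ {x | x ∈ A.G.cube (s, m) ∨ x - y ∈ A.G.cube (s, m)} →
      (lpTranslate y (v m) - v m : L2Space 𝕜 d) x = 0 := by
    intro m
    have h1 := A.ae_eq_zero_of_mem_cubeSpan (hv m)
    have h2 := (measurePreserving_sub_right (volume : Measure (RSpace d)) y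
      ).quasiMeasurePreserving.ae h1
    filter_upwards [h1, h2, Lp.coeFn_sub (lpTranslate y (v m)) (v m),
      coeFn_lpTranslate y (v m)] with x h3 h4 h5 h6 hx
    replace hx := not_or.1 hx
    rw [h5, Pi.sub_apply, h6, h3 hx.1, h4 hx.2, sub_zero]
  -- Each difference lives on a cube and its translate by at most one side length in every
  -- coordinate. Two of them can interact only if their positions differ by at most 1 in every
  -- coordinate, so the 0/1 interaction matrix has row sums at most 3^d.
  have hschur := norm_sq_sum_le_of_schur (𝕜 := 𝕜) F (fun m => lpTranslate y (v m) - v m)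
    (fun m => C * ρ * ‖v m‖) (fun m m' => if ∀ i, |m' i - m i| ≤ 1 then 1 else 0)
    (fun m m' => by split_ifs <;> norm_num) (fun m m' => by simp_rw [abs_sub_comm])
    (fun m _ m' _ => by
      split_ifs with h
      · rw [one_mul]
        exact (norm_inner_le_norm _ _).trans
          (mul_le_mul (hC' m) (hC' m') (norm_nonneg _) (by positivity))
      · rw [inner_eq_zero_of_disjoint ?_ (hsupp m) (hsupp m')]
        · simp
        · exact Set.disjoint_left.2 fun x hx hx' => h (abs_sub_le_one_of_mem_cube A.G hy hx hx'))
    (K := 3 ^ d) (fun m _ => by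
      rw [Finset.sum_ite, Finset.sum_const_zero, add_zero, Finset.sum_const, nsmul_eq_mul, mul_one]
      have h1 : F.filter (fun m' => ∀ i, |m' i - m i| ≤ 1) ⊆
          Fintype.piFinset fun i => Finset.Icc (m i - 1) (m i + 1) := by
        intro m' hm'
        rw [Fintype.mem_piFinset]
        intro i
        have := abs_le.1 ((Finset.mem_filter.1 hm').2 i)
        rw [Finset.mem_Icc]
        omega
      have h2 := Finset.card_le_card h1
      rw [Fintype.card_piFinset] at h2
      simp only [Int.card_Icc, show ∀ a : ℤ, (a + 1 + 1 - (a - 1)).toNat = 3 by intro a; omega,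
        Finset.prod_const, Finset.card_univ, Fintype.card_fin] at h2
      exact_mod_cast h2)
  have horth : ‖∑ m ∈ F, v m‖ ^ 2 = ∑ m ∈ F, ‖v m‖ ^ 2 := by
    have h := inner_self_eq_norm_sq_to_K (𝕜 := 𝕜) (∑ m ∈ F, v m)
    rw [sum_inner] at h
    have h2 : ∀ m ∈ F, inner 𝕜 (v m) (∑ m' ∈ F, v m') = ((‖v m‖ ^ 2 : ℝ) : 𝕜) := by
      intro m hm
      rw [inner_sum, Finset.sum_eq_single m, inner_self_eq_norm_sq_to_K]
      · push_cast; rfl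
      · exact fun m' _ h => A.inner_eq_zero_of_mem_cubeSpan 𝕜 h.symm (hv m) (hv m')
      · exact fun h => absurd hm h
    rw [Finset.sum_congr rfl h2] at h
    exact_mod_cast h.symm
  have hsum : lpTranslate y (∑ m ∈ F, v m) - ∑ m ∈ F, v m =
      ∑ m ∈ F, (lpTranslate y (v m) - v m) := by
    rw [map_sum, Finset.sum_sub_distrib]
  rw [hsum]
  refine le_of_sq_le_sq (hschur.trans (le_of_eq ?_)) (by positivity)
  simp_rw [mul_pow]
  rw [← Finset.mul_sum, ← horth, Real.sq_sqrt (by positivity : (0 : ℝ) ≤ 3 ^ d)]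
  ring

end SmoothAlpert

/-! ### Mollification as an average of translations. -/

namespace AlpertMollifier

variable {d κ : ℕ} (Φ : AlpertMollifier d κ)

lemma hasCompactSupport : HasCompactSupport Φ.φ :=
  (Metric.isBounded_ball.subset Φ.support).isCompact_closure.of_isClosed_subset
    (isClosed_tsupport Φ.φ) subset_closure

lemma continuous_dilate (t : ℝ) : Continuous (dilate Φ.φ t) := by
  unfold dilate
  exact continuous_const.mul (Φ.smooth.continuous.comp (by fun_prop))

lemma hasCompactSupport_dilate {t : ℝ} (ht : 0 < t) : HasCompactSupport (dilate Φ.φ t) :=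
  (Φ.hasCompactSupport.comp_smul (inv_ne_zero ht.ne')).mul_left (f := fun _ => (t ^ d)⁻¹)

lemma integrable_dilate {t : ℝ} (ht : 0 < t) : Integrable (dilate Φ.φ t) :=
  (Φ.continuous_dilate t).integrable_of_hasCompactSupport (Φ.hasCompactSupport_dilate ht)

lemma integral_dilate {t : ℝ} (ht : 0 < t) : ∫ y, dilate Φ.φ t y = 1 := by
  unfold dilate
  rw [integral_const_mul, Measure.integral_comp_inv_smul, finrank_euclideanSpace, Fintype.card_fin,
    abs_of_pos (by positivity), Φ.integral_eq_one, smul_eq_mul, mul_one,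
    inv_mul_cancel₀ (by positivity)]

lemma integral_abs_dilate {t : ℝ} (ht : 0 < t) : ∫ y, |dilate Φ.φ t y| = ∫ y, |Φ.φ y| := by
  unfold dilate
  simp_rw [abs_mul]
  rw [integral_const_mul, Measure.integral_comp_inv_smul volume (fun y => |Φ.φ y|), finrank_euclideanSpace, Fintype.card_fin, abs_of_pos (by positivity),
    abs_of_pos (by positivity), smul_eq_mul, inv_mul_cancel_left₀ (by positivity)]

lemma dilate_eq_zero {t : ℝ} (ht : 0 < t) {y : RSpace d} (hy : t < ‖y‖) : dilate Φ.φ t y = 0 := by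
  have h : t⁻¹ • y ∉ tsupport Φ.φ := fun h => by
    have := Φ.support h
    rw [mem_ball_zero_iff, norm_smul, norm_inv, Real.norm_eq_abs, abs_of_pos ht,
      inv_mul_lt_iff₀ ht, mul_one] at this
    linarith
  rw [dilate, image_eq_zero_of_notMem_tsupport h, mul_zero]

variable {𝕜 : Type*} [RCLike 𝕜]

/-- Mollification at scale `t`, as an average of translations. -/
noncomputable def mollify (t : ℝ) (v : L2Space 𝕜 d) : L2Space 𝕜 d :=
  ∫ y, (dilate Φ.φ t y : 𝕜) • lpTranslate y v

lemma integrable_smul_of_continuous {E : Type*} [NormedAddCommGroup E] [NormedSpace 𝕜 E] {t : ℝ}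
    (ht : 0 < t) {g : RSpace d → E} (hg : Continuous g) :
    Integrable fun y => (dilate Φ.φ t y : 𝕜) • g y := by
  refine Continuous.integrable_of_hasCompactSupport ?_ ?_
  · exact (RCLike.continuous_ofReal.comp (Φ.continuous_dilate t)).smul hg
  · refine HasCompactSupport.smul_right ?_
    exact (Φ.hasCompactSupport_dilate ht).comp_left (g := fun r : ℝ => (r : 𝕜)) RCLike.ofReal_zero

/-- Since φ has integral 1, the mollification error is a φ-weighted average of the differences `v -
lpTranslate y v`, so bounds on translates carry over at the cost of the L¹ norm of φ. -/
lemma sub_mollify {t : ℝ} (ht : 0 < t) (v : L2Space 𝕜 d) :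
    v - Φ.mollify t v = ∫ y, (dilate Φ.φ t y : 𝕜) • (v - lpTranslate y v) := by
  simp_rw [smul_sub]
  rw [integral_sub (Φ.integrable_smul_of_continuous ht continuous_const)
    (Φ.integrable_smul_of_continuous ht (continuous_lpTranslate v)), integral_smul_const,
    integral_ofReal, Φ.integral_dilate ht, RCLike.ofReal_one, one_smul, mollify]

lemma norm_integral_smul_le {E : Type*} [NormedAddCommGroup E] [NormedSpace 𝕜 E] [NormedSpace ℝ E]
    {t : ℝ} (ht : 0 < t) {g : RSpace d → E} {D : ℝ} (hD : ∀ y, ‖y‖ ≤ t → ‖g y‖ ≤ D) :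
    ‖∫ y, (dilate Φ.φ t y : 𝕜) • g y‖ ≤ (∫ y, |Φ.φ y|) * D := by
  rw [← Φ.integral_abs_dilate ht, ← integral_mul_const]
  refine norm_integral_le_of_norm_le ((Φ.integrable_dilate ht).abs.mul_const D)
    (Filter.Eventually.of_forall fun y => ?_)
  rw [norm_smul, RCLike.norm_ofReal]
  rcases le_or_gt ‖y‖ t with hy | hy
  · exact mul_le_mul_of_nonneg_left (hD y hy) (abs_nonneg _)
  · rw [Φ.dilate_eq_zero ht hy]; simp

lemma norm_sub_mollify_le {t : ℝ} (ht : 0 < t) {v : L2Space 𝕜 d} {D : ℝ}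
    (hD : ∀ y : RSpace d, ‖y‖ ≤ t → ‖lpTranslate y v - v‖ ≤ D) :
    ‖v - Φ.mollify t v‖ ≤ (∫ y, |Φ.φ y|) * D := by
  rw [Φ.sub_mollify ht]
  exact Φ.norm_integral_smul_le ht fun y hy => by rw [norm_sub_rev]; exact hD y hy

lemma norm_inner_sub_mollify_right_le {t : ℝ} (ht : 0 < t) {x v : L2Space 𝕜 d} {B : ℝ}
    (hB : ∀ y : RSpace d, ‖inner 𝕜 x (v - lpTranslate y v)‖ ≤ B) :
    ‖inner 𝕜 x (v - Φ.mollify t v)‖ ≤ (∫ y, |Φ.φ y|) * B := by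
  have hint := Φ.integrable_smul_of_continuous (𝕜 := 𝕜) ht
    (g := fun y => v - lpTranslate y v) (continuous_const.sub (continuous_lpTranslate v))
  rw [Φ.sub_mollify ht, ← integral_inner hint]
  simp_rw [inner_smul_right, ← smul_eq_mul]
  exact Φ.norm_integral_smul_le ht (g := fun y => inner 𝕜 x (v - lpTranslate y v)) fun y _ => hB y

/-- Both errors are averages of differences. The inner product of two such differences expands into
four terms, each of which reduces to the hypothesis because translations are isometries; hence 4
`B`, with one L¹ norm of φ for each average. The scales `t`, `t'` do not enter the bound. -/
lemma norm_inner_sub_mollify_sub_mollify_le {t t' : ℝ} (ht : 0 < t) (ht' : 0 < t')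
    {v w : L2Space 𝕜 d} {B : ℝ} (hB : ∀ y : RSpace d, ‖inner 𝕜 (lpTranslate y v) w‖ ≤ B) :
    ‖inner 𝕜 (v - Φ.mollify t v) (w - Φ.mollify t' w)‖ ≤ (∫ y, |Φ.φ y|) ^ 2 * (4 * B) := by
  have hB2 : ∀ y z : RSpace d, ‖inner 𝕜 (lpTranslate y v) (lpTranslate z w)‖ ≤ B := fun y z => by
    rw [inner_lpTranslate_lpTranslate]; exact hB _
  rw [sq, mul_assoc]
  refine Φ.norm_inner_sub_mollify_right_le ht' fun z => ?_
  rw [norm_inner_symm]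
  refine Φ.norm_inner_sub_mollify_right_le ht fun y => ?_
  rw [norm_inner_symm, inner_sub_left, inner_sub_right, inner_sub_right]
  have h1 := hB2 0 0
  have h2 := hB2 0 z
  have h3 := hB2 y 0
  have h4 := hB2 y z
  rw [lpTranslate_zero] at h1 h2 h3
  rw [lpTranslate_zero] at h1
  refine (norm_sub_le _ _).trans ?_
  linarith [norm_sub_le (inner 𝕜 v w) (inner 𝕜 v (lpTranslate z w)),
    norm_sub_le (inner 𝕜 (lpTranslate y v) w) (inner 𝕜 (lpTranslate y v) (lpTranslate z w))]

lemma mollify_sum {t : ℝ} (ht : 0 < t) {ι : Type*} (F : Finset ι) (c : ι → 𝕜)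
    (v : ι → L2Space 𝕜 d) :
    Φ.mollify t (∑ i ∈ F, c i • v i) = ∑ i ∈ F, c i • Φ.mollify t (v i) := by
  unfold mollify
  simp_rw [map_sum, map_smul, Finset.smul_sum, smul_comm _ (c _)]
  have hint : ∀ i ∈ F, Integrable fun y : RSpace d =>
      c i • (dilate Φ.φ t y : 𝕜) • lpTranslate y (v i) := fun i _ =>
    (Φ.integrable_smul_of_continuous ht (continuous_lpTranslate (v i))).smul (c i)
  rw [integral_finsetSum _ hint]
  simp_rw [integral_smul]

end AlpertMollifier

namespace SmoothAlpert

variable {d κ N : ℕ} {Φ : AlpertMollifier d κ} (A : SmoothAlpert Φ N)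
variable (𝕜 : Type*) [RCLike 𝕜]

lemma hη_apply (k : CubeIndex d × Fin N) (x : RSpace d) :
    (A.hη k x : 𝕜) = ∫ y, (dilate Φ.φ (A.η * CubeIndex.side k.1) y : 𝕜) * (A.h k (x - y) : 𝕜) := by
  have h1 : A.hη k x = ∫ y, dilate Φ.φ (A.η * CubeIndex.side k.1) y * A.h k (x - y) := by
    rw [← integral_sub_left_eq_self _ volume x]
    simp only [hη, AlpertBasis.smoothWavelet, convolution_def, ContinuousLinearMap.lsmul_apply,
      smul_eq_mul, sub_sub_cancel, h]
    exact integral_congr_ae (Filter.Eventually.of_forall fun y => mul_comm _ _)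
  rw [h1, ← integral_ofReal]
  push_cast
  rfl

/-- The Bochner average in L² and the pointwise convolution are identified by comparing integrals
over sets of finite measure, using Fubini. -/
lemma mollify_hLp (k : CubeIndex d × Fin N) :
    Φ.mollify (A.η * CubeIndex.side k.1) (A.hLp 𝕜 2 k) = A.hηLp 𝕜 2 k := by
  set t := A.η * CubeIndex.side k.1 with ht'
  have ht : 0 < t := mul_pos A.η_pos (CubeIndex.side_pos _)
  have hint : ∀ (f : L2Space 𝕜 d) (s : Set (RSpace d)), MeasurableSet s → volume s < ⊤ →
      IntegrableOn f s := by
    intro f s _ hs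
    have : IsFiniteMeasure ((volume : Measure (RSpace d)).restrict s) :=
      isFiniteMeasure_restrict.2 hs.ne
    exact ((Lp.memLp f).restrict _).integrable (by norm_num)
  refine Lp.ext (Lp.ae_eq_of_forall_setIntegral_eq _ _ (by norm_num) (by norm_num) (hint _)
    (hint _) fun s hs hsv => ?_)
  have hφ : Integrable fun y => (dilate Φ.φ t y : 𝕜) := (Φ.integrable_dilate ht).ofReal
  have hh : Integrable fun y => (A.h k y : 𝕜) :=
    memLp_one_iff_integrable.1 (A.w.memLp_wavelet A.G 𝕜 1 k.1 k.2)
  have hprod := (hφ.convolution_integrand (ContinuousLinearMap.mul 𝕜 𝕜) hh).restrict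
    (s := s ×ˢ Set.univ)
  rw [← Measure.prod_restrict, Measure.restrict_univ] at hprod
  rw [← L2.inner_indicatorConstLp_one hs hsv.ne, AlpertMollifier.mollify,
    ← integral_inner (Φ.integrable_smul_of_continuous ht (continuous_lpTranslate _))]
  have h1 : ∀ y, inner 𝕜 (indicatorConstLp 2 hs hsv.ne (1 : 𝕜))
      ((dilate Φ.φ t y : 𝕜) • lpTranslate y (A.hLp 𝕜 2 k)) =
      ∫ x in s, (dilate Φ.φ t y : 𝕜) * (A.h k (x - y) : 𝕜) := by
    intro y
    rw [inner_smul_right, L2.inner_indicatorConstLp_one, integral_const_mul]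
    congr 1
    refine setIntegral_congr_ae hs ?_
    have h3 := (measurePreserving_sub_right (volume : Measure (RSpace d)) y
      ).quasiMeasurePreserving.ae (A.coeFn_hLp 𝕜 k)
    filter_upwards [coeFn_lpTranslate y (A.hLp 𝕜 2 k), h3] with x h4 h5 _
    rw [h4, h5]
  simp_rw [h1]
  rw [setIntegral_congr_ae hs ((A.coeFn_hηLp 𝕜 k).mono fun x hx _ => hx)]
  simp_rw [A.hη_apply 𝕜 k]
  exact (integral_integral_swap hprod).symm

end SmoothAlpert

/-! ### Projections on polynomials over a cube. -/

section PolynomialProjection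

variable {d n : ℕ}

instance : IsFiniteMeasure ((volume : Measure (RSpace d)).restrict (unitCube d)) :=
  isFiniteMeasure_restrict.2 (isBounded_halfOpenCube _ _).measure_lt_top.ne

lemma memLp_of_mem_polyFun {q : RSpace d → ℝ} (hq : q ∈ polyFun d n) :
    MemLp q 2 (volume.restrict (unitCube d)) := by
  obtain ⟨C, -, hC⟩ := exists_bound_of_mem_polyFun hq
  exact MemLp.of_bound (continuous_of_mem_polyFun hq).aestronglyMeasurable C
    ((ae_restrict_iff' (measurableSet_halfOpenCube _ _)).2 (Filter.Eventually.of_forall hC))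

lemma inner_toLp_toLp {g g' : RSpace d → ℝ} (hg : MemLp g 2 (volume.restrict (unitCube d)))
    (hg' : MemLp g' 2 (volume.restrict (unitCube d))) :
    inner ℝ hg.toLp hg'.toLp = ∫ x in unitCube d, g x * g' x := by
  rw [L2.inner_def]
  refine integral_congr_ae ?_
  filter_upwards [hg.coeFn_toLp, hg'.coeFn_toLp] with x h1 h2
  rw [h1, h2, real_inner_eq_re_inner, RCLike.inner_apply]
  simp [mul_comm]

/-- Polynomial functions as elements of `L²` of the unit cube. -/
noncomputable def polyToLp (d n : ℕ) :
    polyFun d n →ₗ[ℝ] Lp ℝ 2 ((volume : Measure (RSpace d)).restrict (unitCube d)) where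
  toFun q := (memLp_of_mem_polyFun q.2).toLp
  map_add' _ _ := rfl
  map_smul' _ _ := rfl

lemma exists_projection {g : RSpace d → ℝ} (hg : MemLp g 2 (volume.restrict (unitCube d))) :
    ∃ q ∈ polyFun d n, ∀ r ∈ polyFun d n,
      ∫ x in unitCube d, g x * r x = ∫ x in unitCube d, q x * r x := by
  have := finiteDimensional_polyFun d n
  set K := LinearMap.range (polyToLp d n)
  obtain ⟨q, hq⟩ : K.starProjection hg.toLp ∈ K := K.starProjection_apply_mem _
  refine ⟨q, q.2, fun r hr => ?_⟩
  have h := Submodule.starProjection_inner_eq_zero (K := K) hg.toLp _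
    (LinearMap.mem_range_self (polyToLp d n) ⟨r, hr⟩)
  rw [← hq, inner_sub_left, sub_eq_zero] at h
  rw [← inner_toLp_toLp hg (memLp_of_mem_polyFun hr),
    ← inner_toLp_toLp (memLp_of_mem_polyFun q.2) (memLp_of_mem_polyFun hr)]
  exact h

/-- The projection is bounded from L¹ to L²: polynomials have a finite orthonormal basis of bounded
functions, so each coefficient of the projection is at most a sup norm times the L¹ norm of `g`. The
L¹ norm matters, because for an indicator it is far smaller than the L² norm. -/
lemma exists_integral_sq_projection_le (d n : ℕ) : ∃ C, 0 ≤ C ∧ ∀ g q : RSpace d → ℝ,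
    MemLp g 2 (volume.restrict (unitCube d)) → q ∈ polyFun d n →
    (∀ r ∈ polyFun d n, ∫ x in unitCube d, g x * r x = ∫ x in unitCube d, q x * r x) →
    ∫ x in unitCube d, q x ^ 2 ≤ C * (∫ x in unitCube d, |g x|) ^ 2 := by
  have := finiteDimensional_polyFun d n
  set K := LinearMap.range (polyToLp d n)
  let b := stdOrthonormalBasis ℝ K
  choose e he using fun i => (b i).2
  choose M hM0 hM using fun i => exists_bound_of_mem_polyFun (e i).2
  refine ⟨∑ i, M i ^ 2, Finset.sum_nonneg fun i _ => sq_nonneg _, fun g q hg hq h => ?_⟩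
  have hgi : Integrable g (volume.restrict (unitCube d)) := hg.integrable (by norm_num)
  let Q : K := ⟨polyToLp d n ⟨q, hq⟩, LinearMap.mem_range_self _ _⟩
  have h1 : ∫ x in unitCube d, q x ^ 2 = ‖Q‖ ^ 2 := by
    rw [← real_inner_self_eq_norm_sq]
    change _ = inner ℝ (memLp_of_mem_polyFun hq).toLp (memLp_of_mem_polyFun hq).toLp
    rw [inner_toLp_toLp]
    simp_rw [sq]
  have h2 : ∀ i, ‖inner ℝ (b i) Q‖ ≤ M i * ∫ x in unitCube d, |g x| := by
    intro i
    have h3 : inner ℝ (b i) Q = ∫ x in unitCube d, g x * (e i : RSpace d → ℝ) x := by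
      rw [h _ (e i).2, Submodule.coe_inner, ← he i, real_inner_comm]
      exact inner_toLp_toLp (memLp_of_mem_polyFun hq) (memLp_of_mem_polyFun (e i).2)
    rw [h3, ← integral_const_mul]
    refine norm_integral_le_of_norm_le (hgi.abs.const_mul _) ?_
    refine (ae_restrict_iff' (measurableSet_halfOpenCube _ _)).2
      (Filter.Eventually.of_forall fun x hx => ?_)
    rw [norm_mul, Real.norm_eq_abs, Real.norm_eq_abs, mul_comm]
    exact mul_le_mul_of_nonneg_right (hM i x hx) (abs_nonneg _)
  rw [h1, ← b.sum_sq_norm_inner_right Q, Finset.sum_mul]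
  refine Finset.sum_le_sum fun i _ => ?_
  rw [← mul_pow]
  exact pow_le_pow_left₀ (norm_nonneg _) (h2 i) 2

end PolynomialProjection

section Cubes

variable {d : ℕ} (G : DyadicGrid d)

lemma setIntegral_comp_chart (I : CubeIndex d) (F : RSpace d → ℝ) :
    ∫ x in G.cube I, F (G.chart I x) = CubeIndex.side I ^ d * ∫ x in unitCube d, F x := by
  have hm : MeasurableSet (unitCube d) := measurableSet_halfOpenCube _ _
  rw [← integral_indicator (G.measurableSet_cube I), ← integral_indicator hm, ← smul_eq_mul,
    ← integral_comp_chart G I]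
  congr 1
  ext x
  by_cases hx : x ∈ G.cube I
  · rw [Set.indicator_of_mem hx, Set.indicator_of_mem ((G.mem_cube_iff I x).1 hx)]
  · rw [Set.indicator_of_notMem hx,
      Set.indicator_of_notMem fun h => hx ((G.mem_cube_iff I x).2 h)]

lemma continuous_chart (I : CubeIndex d) : Continuous (G.chart I) := by
  unfold DyadicGrid.chart
  fun_prop

/-- `q` is, in the coordinates of the cube `I`, the projection of the indicator of `J ⊆ I` on the
polynomials. -/
def IsCubeProjection (n : ℕ) (J I : CubeIndex d) (q : RSpace d → ℝ) : Prop :=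
  q ∈ polyFun d n ∧ ∀ r ∈ polyFun d n, ∫ x in G.cube J, r (G.chart I x) =
    ∫ x in G.cube I, q (G.chart I x) * r (G.chart I x)

/-- The cube `J` in the coordinates of the cube `I`. -/
noncomputable def cubeImage (J I : CubeIndex d) : Set (RSpace d) :=
  (fun y => CubeIndex.side I • y + G.corner I) ⁻¹' G.cube J

lemma chart_mem_cubeImage (J I : CubeIndex d) (x : RSpace d) :
    G.chart I x ∈ cubeImage G J I ↔ x ∈ G.cube J := by
  rw [cubeImage, Set.mem_preimage, DyadicGrid.chart, smul_inv_smul₀ (CubeIndex.side_pos I).ne',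
    sub_add_cancel]

lemma measurableSet_cubeImage (J I : CubeIndex d) : MeasurableSet (cubeImage G J I) :=
  measurableSet_preimage (by fun_prop) (G.measurableSet_cube J)

lemma memLp_indicator_cubeImage (J I : CubeIndex d) :
    MemLp ((cubeImage G J I).indicator 1 : RSpace d → ℝ) 2 (volume.restrict (unitCube d)) := by
  refine MemLp.of_bound ((measurable_one.indicator
    (measurableSet_cubeImage G J I)).aestronglyMeasurable) 1 (Filter.Eventually.of_forall fun x => ?_)
  by_cases hx : x ∈ cubeImage G J I <;> simp [hx]

lemma setIntegral_indicator_cubeImage_mul {J I : CubeIndex d} (hJI : G.cube J ⊆ G.cube I)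
    (r : RSpace d → ℝ) : CubeIndex.side I ^ d *
      ∫ x in unitCube d, (cubeImage G J I).indicator 1 x * r x = ∫ x in G.cube J, r (G.chart I x) := by
  rw [← setIntegral_comp_chart G I fun x => (cubeImage G J I).indicator 1 x * r x]
  have h1 : ∀ x, (cubeImage G J I).indicator 1 (G.chart I x) * r (G.chart I x) =
      (G.cube J).indicator (fun x => r (G.chart I x)) x := by
    intro x
    by_cases hx : x ∈ G.cube J
    · rw [Set.indicator_of_mem hx, Set.indicator_of_mem ((chart_mem_cubeImage G J I x).2 hx),
        Pi.one_apply, one_mul]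
    · rw [Set.indicator_of_notMem hx,
        Set.indicator_of_notMem fun h => hx ((chart_mem_cubeImage G J I x).1 h), zero_mul]
  simp_rw [h1]
  rw [setIntegral_indicator (G.measurableSet_cube J), Set.inter_eq_right.2 hJI]

lemma isCubeProjection_iff {n : ℕ} {J I : CubeIndex d} (hJI : G.cube J ⊆ G.cube I)
    {q : RSpace d → ℝ} : IsCubeProjection G n J I q ↔ q ∈ polyFun d n ∧ ∀ r ∈ polyFun d n,
      ∫ x in unitCube d, (cubeImage G J I).indicator 1 x * r x = ∫ x in unitCube d, q x * r x := by
  have := CubeIndex.side_pos I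
  refine and_congr_right fun _ => forall₂_congr fun r _ => ?_
  rw [← setIntegral_indicator_cubeImage_mul G hJI, setIntegral_comp_chart G I fun x => q x * r x,
    mul_right_inj' (by positivity)]

lemma exists_isCubeProjection (n : ℕ) {J I : CubeIndex d} (hJI : G.cube J ⊆ G.cube I) :
    ∃ q, IsCubeProjection G n J I q := by
  obtain ⟨q, hq, h⟩ := exists_projection (n := n) (memLp_indicator_cubeImage G J I)
  exact ⟨q, (isCubeProjection_iff G hJI).2 ⟨hq, h⟩⟩

/-- In the coordinates of `I` the indicator of `J` has L¹ norm |J|/|I|. Squaring and scaling back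
gives |J|²/|I|, which decays as `I` grows. -/
lemma exists_integral_sq_isCubeProjection_le (d n : ℕ) : ∃ C, 0 ≤ C ∧ ∀ (G : DyadicGrid d)
    (J I : CubeIndex d) (q : RSpace d → ℝ), G.cube J ⊆ G.cube I → IsCubeProjection G n J I q →
    ∫ x in G.cube I, q (G.chart I x) ^ 2 ≤
      C * (CubeIndex.side J ^ d) ^ 2 * (CubeIndex.side I ^ d)⁻¹ := by
  obtain ⟨C, hC0, hC⟩ := exists_integral_sq_projection_le d n
  refine ⟨C, hC0, fun G J I q hJI hq => ?_⟩
  have hI := CubeIndex.side_pos I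
  have hJ := CubeIndex.side_pos J
  obtain ⟨h1, h2⟩ := (isCubeProjection_iff G hJI).1 hq
  have h3 := hC _ q (memLp_indicator_cubeImage G J I) h1 h2
  have h4 : CubeIndex.side I ^ d * ∫ x in unitCube d, |(cubeImage G J I).indicator 1 x| =
      CubeIndex.side J ^ d := by
    have h5 := setIntegral_indicator_cubeImage_mul G hJI fun _ => 1
    simp only [mul_one, setIntegral_const, smul_eq_mul] at h5
    rw [measureReal_def, DyadicGrid.cube, volume_halfOpenCube _ hJ.le,
      ENNReal.toReal_ofReal (by positivity)] at h5
    rw [← h5]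
    congr 2
    ext x
    exact abs_of_nonneg (Set.indicator_nonneg (fun _ _ => zero_le_one) _)
  rw [setIntegral_comp_chart G I fun x => q x ^ 2, ← h4]
  calc _ ≤ CubeIndex.side I ^ d *
        (C * (∫ x in unitCube d, |(cubeImage G J I).indicator 1 x|) ^ 2) := by gcongr
    _ = _ := by field_simp

end Cubes

section Pairing

variable {d : ℕ} {𝕜 : Type*} [RCLike 𝕜]

lemma integrable_mul_of_memLp {g : RSpace d → ℝ}
    (hg : MemLp (fun x => (g x : 𝕜)) 2 (volume : Measure (RSpace d))) (f : L2Space 𝕜 d) :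
    Integrable fun x => f x * (g x : 𝕜) :=
  (Lp.memLp f).integrable_mul hg

lemma pairing_sub {g g' : RSpace d → ℝ}
    (hg : MemLp (fun x => (g x : 𝕜)) 2 (volume : Measure (RSpace d)))
    (hg' : MemLp (fun x => (g' x : 𝕜)) 2 (volume : Measure (RSpace d))) (f : L2Space 𝕜 d) :
    pairing f (fun x => g x - g' x) = pairing f g - pairing f g' := by
  unfold pairing
  rw [← integral_sub (integrable_mul_of_memLp hg f) (integrable_mul_of_memLp hg' f)]
  simp_rw [RCLike.ofReal_sub, mul_sub]

lemma norm_pairing_le {g : RSpace d → ℝ}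
    (hg : MemLp (fun x => (g x : 𝕜)) 2 (volume : Measure (RSpace d))) (f : L2Space 𝕜 d) :
    ‖pairing f g‖ ≤ √(∫ x, g x ^ 2) * ‖f‖ := by
  have h1 : ‖hg.toLp‖ ^ 2 = ∫ x, g x ^ 2 := by
    rw [norm_sq_eq_integral]
    refine integral_congr_ae ?_
    filter_upwards [hg.coeFn_toLp] with x hx
    rw [hx, RCLike.norm_ofReal, sq_abs]
  rw [← h1, Real.sqrt_sq (norm_nonneg _), ← SmoothAlpert.inner_eq_pairing hg.coeFn_toLp]
  exact norm_inner_le_norm _ _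

lemma norm_le_mul_of_abs_apply_le {y : RSpace d} {r : ℝ} (hy : ∀ i, |y i| ≤ r) :
    ‖y‖ ≤ d * r := by
  have h1 : ‖y‖ ≤ ∑ i : Fin d, |y i| := by
    rw [EuclideanSpace.norm_eq]
    refine Real.sqrt_le_iff.2 ⟨Finset.sum_nonneg fun i _ => abs_nonneg _, ?_⟩
    exact Finset.sum_sq_le_sq_sum_of_nonneg fun i _ => abs_nonneg _
  refine h1.trans ((Finset.sum_le_sum fun i _ => hy i).trans (le_of_eq ?_))
  simp

/-- The function supported in the cube `I` that is `q` in the coordinates of `I`. -/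
noncomputable def cubeFun (G : DyadicGrid d) (I : CubeIndex d) (q : RSpace d → ℝ) :
    RSpace d → ℝ := (G.cube I).indicator fun x => q (G.chart I x)

lemma memLp_cubeFun (G : DyadicGrid d) (I : CubeIndex d) {n : ℕ} {q : RSpace d → ℝ}
    (hq : q ∈ polyFun d n) :
    MemLp (fun x => (cubeFun G I q x : 𝕜)) 2 (volume : Measure (RSpace d)) := by
  obtain ⟨C, hC0, hC⟩ := exists_bound_of_mem_polyFun hq
  refine AlpertBasis.memLp_of_nice ?_ ⟨C, fun x => ?_⟩ ?_ 2
  · exact (((continuous_of_mem_polyFun hq).comp (continuous_chart G I)).measurable.indicator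
      (G.measurableSet_cube I)).aestronglyMeasurable
  · by_cases hx : x ∈ G.cube I
    · rw [cubeFun, Set.indicator_of_mem hx]
      exact hC _ ((G.mem_cube_iff I x).1 hx)
    · rw [cubeFun, Set.indicator_of_notMem hx, abs_zero]
      exact hC0
  · exact HasCompactSupport.of_support_subset_isCompact
      (isBounded_halfOpenCube (G.corner I) (CubeIndex.side I)).isCompact_closure
      (Set.support_indicator_subset.trans subset_closure)

end Pairing

/-! ### Completeness of the wavelets in L². -/

namespace SmoothAlpert

variable {d κ N : ℕ} {Φ : AlpertMollifier d κ} (A : SmoothAlpert Φ N)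
variable {𝕜 : Type*} [RCLike 𝕜]

lemma pairing_comp_chart_eq_zero {f : L2Space 𝕜 d} (hf : ∀ k, pairing f (A.h k) = 0)
    (I : CubeIndex d) {D : RSpace d → ℝ} (hD : D ∈ alpertSpace d κ) :
    pairing f (fun x => D (A.G.chart I x)) = 0 := by
  obtain ⟨c, rfl⟩ := (Submodule.mem_span_range_iff_exists_fun ℝ).1 (A.w.spanning _ hD)
  have hs := CubeIndex.side_pos I
  have h1 : ∀ x, f x * (((∑ b, c b • A.w.h b) (A.G.chart I x) : ℝ) : 𝕜) =
      ∑ b, ((c b * √(CubeIndex.side I ^ d) : ℝ) : 𝕜) * (f x * (A.h (I, b) x : 𝕜)) := by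
    intro x
    simp only [Finset.sum_apply, Pi.smul_apply, smul_eq_mul, RCLike.ofReal_sum, Finset.mul_sum, h,
      AlpertBasis.wavelet_eq]
    refine Finset.sum_congr rfl fun b _ => ?_
    have h2 : (((√(CubeIndex.side I ^ d))⁻¹ : ℝ) : 𝕜) * ((√(CubeIndex.side I ^ d) : ℝ) : 𝕜) = 1 := by
      rw [← RCLike.ofReal_mul, inv_mul_cancel₀ (by positivity), RCLike.ofReal_one]
    rw [RCLike.ofReal_mul, RCLike.ofReal_mul, RCLike.ofReal_mul]
    linear_combination (-(f x * (c b : 𝕜) * (A.w.h b (A.G.chart I x) : 𝕜))) * h2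
  unfold pairing
  simp_rw [h1]
  have hint : ∀ b ∈ Finset.univ, Integrable fun x =>
      ((c b * √(CubeIndex.side I ^ d) : ℝ) : 𝕜) * (f x * (A.h (I, b) x : 𝕜)) := fun b _ =>
    (integrable_mul_of_memLp (A.w.memLp_wavelet A.G 𝕜 2 I b) f).const_mul _
  rw [integral_finsetSum _ hint]
  refine Finset.sum_eq_zero fun b _ => ?_
  rw [integral_const_mul]
  exact mul_eq_zero_of_right _ (hf (I, b))

/-- On both the child and its parent the projection has the same polynomial moments as the indicator
of `J`. The difference is polynomial on each child of the parent and has vanishing moments, so it is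
an Alpert function of the parent, to which `f` is orthogonal. -/
lemma pairing_cubeFun_eq (hκ : 0 < κ) {f : L2Space 𝕜 d} (hf : ∀ k, pairing f (A.h k) = 0)
    {s : ℤ} {m m' : Fin d → ℤ} {ε : Fin d → Fin 2}
    (hε : ∀ x, x ∈ A.G.cube (s + 1, m') ↔ A.G.chart (s, m) x ∈ unitChild ε) {J : CubeIndex d}
    {q q' : RSpace d → ℝ} (hq : IsCubeProjection A.G (κ - 1) J (s, m) q)
    (hq' : IsCubeProjection A.G (κ - 1) J (s + 1, m') q') :
    pairing f (cubeFun A.G (s + 1, m') q') = pairing f (cubeFun A.G (s, m) q) := by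
  set I : CubeIndex d := (s, m)
  set I' : CubeIndex d := (s + 1, m')
  have hs := CubeIndex.side_pos I
  have hII' : A.G.cube I' ⊆ A.G.cube I := fun x hx =>
    (A.G.mem_cube_iff I x).2 (DyadicGrid.unitChild_subset ε ((hε x).1 hx))
  -- The child's polynomial `q'`, rewritten in the coordinates of the parent.
  let q'' : RSpace d → ℝ := fun z =>
    q' ((CubeIndex.side I / CubeIndex.side I') • z + A.G.chart I' (A.G.corner I))
  have hq'' : q'' ∈ polyFun d (κ - 1) := polyFun_comp_affine hq'.1 _ _
  have hq''e : ∀ x, q'' (A.G.chart I x) = q' (A.G.chart I' x) := fun x => by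
    rw [AlpertBasis.chart_eq A.G I' I x]
  let Q : (Fin d → Fin 2) → RSpace d → ℝ := fun ε' => (if ε' = ε then q'' else 0) - q
  have hQ : ∀ ε', Q ε' ∈ polyFun d (κ - 1) := fun ε' =>
    sub_mem (by split_ifs; exacts [hq'', zero_mem _]) hq.1
  have hD : ∀ x, ∑ ε', (unitChild ε').indicator (Q ε') (A.G.chart I x) =
      cubeFun A.G I' q' x - cubeFun A.G I q x := by
    intro x
    by_cases hx : x ∈ A.G.cube I
    · obtain ⟨ε', hε'⟩ := DyadicGrid.exists_mem_unitChild ((A.G.mem_cube_iff I x).1 hx)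
      rw [sum_indicator_unitChild Q hε', cubeFun, cubeFun, Set.indicator_of_mem hx]
      simp only [Q, Pi.sub_apply]
      congr 1
      split_ifs with h
      · subst h
        rw [Set.indicator_of_mem ((hε x).2 hε'), hq''e]
      · rw [Set.indicator_of_notMem, Pi.zero_apply]
        exact fun h' => Set.disjoint_left.1 (DyadicGrid.disjoint_unitChild h) hε' ((hε x).1 h')
    · rw [cubeFun, cubeFun, Set.indicator_of_notMem hx, Set.indicator_of_notMem fun h => hx (hII' h),
        sub_zero]
      refine Finset.sum_eq_zero fun ε' _ => Set.indicator_of_notMem (fun h => hx ?_) _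
      exact (A.G.mem_cube_iff I x).2 (DyadicGrid.unitChild_subset ε' h)
  have hmem : (fun z => ∑ ε', (unitChild ε').indicator (Q ε') z) ∈ alpertSpace d κ := by
    refine mem_alpertSpace_of hκ Q hQ fun r hr => ?_
    have hr' := polyFun_comp_affine hr (CubeIndex.side I' / CubeIndex.side I)
      (A.G.chart I (A.G.corner I'))
    have h1 := hq'.2 _ hr'
    simp_rw [← AlpertBasis.chart_eq A.G I I'] at h1
    have hint : ∀ (K : CubeIndex d) (p : RSpace d → ℝ), p ∈ polyFun d (κ - 1) →
        IntegrableOn (fun x => cubeFun A.G K p x * r (A.G.chart I x)) (A.G.cube I) := by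
      intro K p hp
      have h2 := (memLp_cubeFun (𝕜 := ℝ) A.G K hp).integrable_mul
        (memLp_cubeFun (𝕜 := ℝ) A.G I hr)
      refine (h2.integrableOn (s := A.G.cube I)).congr_fun (fun x hx => ?_)
        (A.G.measurableSet_cube I)
      simp [cubeFun, Set.indicator_of_mem hx]
    refine (mul_eq_zero.1 (?_ : CubeIndex.side I ^ d * _ = 0)).resolve_left (by positivity)
    rw [← setIntegral_comp_chart A.G I fun z => (∑ ε', (unitChild ε').indicator (Q ε') z) * r z]
    simp_rw [hD, sub_mul]
    rw [integral_sub (hint I' q' hq'.1) (hint I q hq.1), sub_eq_zero]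
    have h3 : ∫ x in A.G.cube I, cubeFun A.G I q x * r (A.G.chart I x) =
        ∫ x in A.G.cube I, q (A.G.chart I x) * r (A.G.chart I x) :=
      setIntegral_congr_fun (A.G.measurableSet_cube I) fun x hx => by
        simp only [cubeFun, Set.indicator_of_mem hx]
    have h4 : ∫ x in A.G.cube I, cubeFun A.G I' q' x * r (A.G.chart I x) =
        ∫ x in A.G.cube I', q' (A.G.chart I' x) * r (A.G.chart I x) := by
      rw [← Set.inter_eq_right.2 hII', ← setIntegral_indicator (A.G.measurableSet_cube I')]
      congr 1
      ext x
      by_cases hx : x ∈ A.G.cube I' <;> simp [cubeFun, hx]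
    rw [h3, h4, ← h1, ← hq.2 r hr]
  have h := A.pairing_comp_chart_eq_zero hf I hmem
  simp_rw [hD] at h
  rwa [pairing_sub (memLp_cubeFun A.G I' hq'.1) (memLp_cubeFun A.G I hq.1), sub_eq_zero] at h

/-- Climbs `n` generations. At each one the original indicator is projected afresh, and its
projection on its own cube is the constant 1, which starts the induction. -/
lemma exists_pairing_cubeFun_eq (hκ : 0 < κ) {f : L2Space 𝕜 d} (hf : ∀ k, pairing f (A.h k) = 0)
    (n : ℕ) (t : ℤ) (m : Fin d → ℤ) : ∃ (s : ℤ) (m' : Fin d → ℤ) (q : RSpace d → ℝ), t = s + n ∧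
      A.G.cube (t, m) ⊆ A.G.cube (s, m') ∧ IsCubeProjection A.G (κ - 1) (t, m) (s, m') q ∧
      pairing f ((A.G.cube (t, m)).indicator 1) = pairing f (cubeFun A.G (s, m') q) := by
  induction n with
  | zero =>
    exact ⟨t, m, fun _ => 1, by simp, subset_rfl, ⟨one_mem_polyFun _ _, fun r _ => by simp⟩, rfl⟩
  | succ n ih =>
    obtain ⟨s, m', q', hs, hsub, hq', h⟩ := ih
    obtain ⟨s, rfl⟩ : ∃ s', s = s' + 1 := ⟨s - 1, by ring⟩
    obtain ⟨m'', ε, hε⟩ := A.G.exists_parent s m'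
    have hsub' : A.G.cube (t, m) ⊆ A.G.cube (s, m'') := fun x hx =>
      (A.G.mem_cube_iff (s, m'') x).2 (DyadicGrid.unitChild_subset ε ((hε x).1 (hsub hx)))
    obtain ⟨q, hq⟩ := exists_isCubeProjection A.G (κ - 1) hsub'
    exact ⟨s, m'', q, by rw [hs]; push_cast; ring, hsub', hq,
      h.trans (A.pairing_cubeFun_eq hκ hf hε hq hq')⟩

/-- The projection on the `n`-th ancestor has L² norm O(2^{-nd/2}), which tends to 0 because `1 ≤
d`, while its pairing with `f` stays equal to the integral. -/
lemma setIntegral_cube_eq_zero (hd : 1 ≤ d) (hκ : 0 < κ) {f : L2Space 𝕜 d}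
    (hf : ∀ k, pairing f (A.h k) = 0) (t : ℤ) (m : Fin d → ℤ) :
    ∫ x in A.G.cube (t, m), f x = 0 := by
  have h1 : ∫ x in A.G.cube (t, m), f x = pairing f ((A.G.cube (t, m)).indicator 1) := by
    rw [pairing, ← integral_indicator (A.G.measurableSet_cube _)]
    congr 1
    ext x
    by_cases hx : x ∈ A.G.cube (t, m) <;> simp [hx]
  obtain ⟨C, hC0, hC⟩ := exists_integral_sq_isCubeProjection_le d (κ - 1)
  set K := C * (CubeIndex.side ((t, m) : CubeIndex d) ^ d) ^ 2 * ((2 : ℝ) ^ t) ^ d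
  have hbound : ∀ n : ℕ, ‖∫ x in A.G.cube (t, m), f x‖ ≤ √(K * ((1 / 2 : ℝ) ^ d) ^ n) * ‖f‖ := by
    intro n
    obtain ⟨s, m', q, hs, hsub, hq, h⟩ := A.exists_pairing_cubeFun_eq hκ hf n t m
    rw [h1, h]
    refine (norm_pairing_le (memLp_cubeFun A.G (s, m') hq.1) f).trans ?_
    gcongr
    have h2 : ∫ x, cubeFun A.G (s, m') q x ^ 2 =
        ∫ x in A.G.cube (s, m'), q (A.G.chart (s, m') x) ^ 2 := by
      rw [← integral_indicator (A.G.measurableSet_cube _)]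
      congr 1
      ext x
      by_cases hx : x ∈ A.G.cube (s, m') <;> simp [cubeFun, hx]
    rw [h2]
    refine (hC A.G (t, m) (s, m') q hsub hq).trans (le_of_eq ?_)
    have h3 : (CubeIndex.side ((s, m') : CubeIndex d) ^ d)⁻¹ =
        ((2 : ℝ) ^ t) ^ d * ((1 / 2 : ℝ) ^ d) ^ n := by
      simp only [CubeIndex.side]
      rw [← inv_pow, zpow_neg, inv_inv, pow_right_comm, ← mul_pow, hs, zpow_add₀ two_ne_zero,
        zpow_natCast, mul_assoc, ← mul_pow]
      norm_num
    rw [h3]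
    ring
  have hlim : Filter.Tendsto (fun n : ℕ => √(K * ((1 / 2 : ℝ) ^ d) ^ n) * ‖f‖) Filter.atTop
      (nhds (√(K * 0) * ‖f‖)) := by
    refine Filter.Tendsto.mul_const _ (Filter.Tendsto.sqrt (Filter.Tendsto.const_mul _ ?_))
    exact tendsto_pow_atTop_nhds_zero_of_lt_one (by positivity)
      (pow_lt_one₀ (by norm_num) (by norm_num) (by omega))
  rw [mul_zero, Real.sqrt_zero, zero_mul] at hlim
  exact norm_le_zero_iff.1 (ge_of_tendsto' hlim hbound)

/-- `f` is paired with itself in `norm_inner_le_of_setIntegral_eq_zero`: its means vanish at every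
scale, and by continuity of translation its oscillation at fine scales is arbitrarily small. -/
lemma eq_zero_of_pairing_eq_zero (hd : 1 ≤ d) (hκ : 0 < κ) {f : L2Space 𝕜 d}
    (hf : ∀ k, pairing f (A.h k) = 0) : f = 0 := by
  have hle : ∀ D > 0, ‖(inner 𝕜 f f : 𝕜)‖ ≤ 2 ^ d * D * ‖f‖ := by
    intro D hD
    obtain ⟨δ, hδ, h⟩ := Metric.continuous_iff.1 (continuous_lpTranslate f) 0 D hD
    -- A vector with coordinates at most 2^{-n} has norm at most d 2^{-n}; dividing by `d + 1` makes
    -- this less than `δ`.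
    obtain ⟨n, hn⟩ := exists_pow_lt_of_lt_one (div_pos hδ (by positivity : (0 : ℝ) < d + 1))
      (by norm_num : (1 / 2 : ℝ) < 1)
    refine norm_inner_le_of_setIntegral_eq_zero A.G n f f
      (fun m => A.setIntegral_cube_eq_zero hd hκ hf n m) fun y hy => ?_
    have hy2 : ‖y‖ < δ := by
      have h1 := norm_le_mul_of_abs_apply_le hy
      rw [zpow_neg, zpow_natCast, ← inv_pow, ← one_div] at h1
      rw [lt_div_iff₀ (by positivity)] at hn
      have h3 : (0 : ℝ) < (1 / 2) ^ n := by positivity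
      linarith
    have := h y (by rwa [dist_zero_right])
    rw [dist_eq_norm, lpTranslate_zero] at this
    exact this.le
  have h0 : ‖(inner 𝕜 f f : 𝕜)‖ ≤ 0 := by
    have hlim : Filter.Tendsto (fun D : ℝ => 2 ^ d * D * ‖f‖) (nhdsWithin 0 (Set.Ioi 0))
        (nhds (2 ^ d * 0 * ‖f‖)) :=
      ((continuous_const.mul continuous_id).mul continuous_const).continuousWithinAt
    rw [mul_zero, zero_mul] at hlim
    exact ge_of_tendsto hlim (Filter.eventually_of_mem self_mem_nhdsWithin hle)
  exact inner_self_eq_zero.1 (norm_le_zero_iff.1 h0)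

/-- The wavelets form an orthonormal basis of `L²`. -/
lemma exists_hilbertBasis (hd : 1 ≤ d) (hκ : 0 < κ) :
    ∃ b : HilbertBasis (CubeIndex d × Fin N) 𝕜 (L2Space 𝕜 d), ∀ k, b k = A.hLp 𝕜 2 k := by
  refine ⟨HilbertBasis.mkOfOrthogonalEqBot (A.orthonormal_hLp 𝕜 hκ) ?_,
    fun k => congrFun (HilbertBasis.coe_mkOfOrthogonalEqBot _ _) k⟩
  refine (Submodule.eq_bot_iff _).2 fun f hf => A.eq_zero_of_pairing_eq_zero hd hκ fun k => ?_
  rw [← inner_eq_pairing (A.coeFn_hLp 𝕜 k)]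
  exact (Submodule.mem_orthogonal _ _).1 hf _ (Submodule.subset_span ⟨k, rfl⟩)

end SmoothAlpert

/-! ### Perturbation of an orthonormal basis. -/

section Perturbation

variable {𝕜 : Type*} [RCLike 𝕜] {H : Type*} [NormedAddCommGroup H] [InnerProductSpace 𝕜 H]

lemma norm_sq_sum_smul {ι : Type*} {v : ι → H} (hv : Orthonormal 𝕜 v) (c : ι → 𝕜)
    (F : Finset ι) : ‖∑ k ∈ F, c k • v k‖ ^ 2 = ∑ k ∈ F, ‖c k‖ ^ 2 := by
  have h := inner_self_eq_norm_sq_to_K (𝕜 := 𝕜) (∑ k ∈ F, c k • v k)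
  rw [hv.inner_sum] at h
  simp_rw [RCLike.conj_mul] at h
  exact_mod_cast h.symm

variable [CompleteSpace H]

/-- The bound on finite sums, with Bessel's inequality, makes the series satisfy the unconditional
Cauchy criterion, and in the limit ‖R‖ ≤ √E. -/
lemma exists_perturbation {ι : Type*} (b : HilbertBasis ι 𝕜 H) (g : ι → H) {E : ℝ} (hE0 : 0 ≤ E)
    (hE1 : E < 1) (hg : ∀ (F : Finset ι) (c : ι → 𝕜),
      ‖∑ k ∈ F, c k • g k‖ ^ 2 ≤ E * ∑ k ∈ F, ‖c k‖ ^ 2) :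
    ∃ R : H →L[𝕜] H, ‖R‖ < 1 ∧ ∀ f, HasSum (fun k => inner 𝕜 (b k) f • g k) (R f) := by
  have hsum : ∀ f, Summable fun k => (inner 𝕜 (b k) f : 𝕜) • g k := by
    intro f
    rw [summable_iff_vanishing_norm]
    intro ε hε
    have h1 := b.orthonormal.inner_products_summable f
    obtain ⟨s, hs⟩ := summable_iff_vanishing_norm.1 h1 (ε ^ 2) (by positivity)
    refine ⟨s, fun t ht => ?_⟩
    have h2 := hs t ht
    rw [Real.norm_of_nonneg (Finset.sum_nonneg fun i _ => sq_nonneg _)] at h2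
    have h3 : 0 ≤ ∑ k ∈ t, ‖(inner 𝕜 (b k) f : 𝕜)‖ ^ 2 := Finset.sum_nonneg fun i _ => sq_nonneg _
    refine lt_of_pow_lt_pow_left₀ 2 hε.le ?_
    nlinarith [hg t fun k => inner 𝕜 (b k) f]
  let R₀ : H →ₗ[𝕜] H :=
    { toFun := fun f => ∑' k, (inner 𝕜 (b k) f : 𝕜) • g k
      map_add' := fun f f' => by
        simp_rw [inner_add_right, add_smul]
        exact (hsum f).tsum_add (hsum f')
      map_smul' := fun c f => by
        simp_rw [inner_smul_right, mul_smul]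
        exact (hsum f).tsum_const_smul c }
  have hR₀ : ∀ f, ‖R₀ f‖ ≤ √E * ‖f‖ := by
    intro f
    refine le_of_tendsto (hsum f).hasSum.norm (Filter.Eventually.of_forall fun F => ?_)
    refine le_of_sq_le_sq ((hg F _).trans ?_) (by positivity)
    rw [mul_pow, Real.sq_sqrt hE0]
    gcongr
    exact b.orthonormal.sum_inner_products_le f
  refine ⟨R₀.mkContinuous (√E) hR₀, ?_, fun f => (hsum f).hasSum⟩
  refine (R₀.mkContinuous_norm_le (Real.sqrt_nonneg _) hR₀).trans_lt ?_
  rw [Real.sqrt_lt' one_pos]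
  simpa using hE1

lemma exists_equiv_one_sub {R : H →L[𝕜] H} (hR : ‖R‖ < 1) :
    ∃ e : H ≃L[𝕜] H, ∀ f, e f = f - R f :=
  ⟨ContinuousLinearEquiv.unitsEquiv 𝕜 H (Units.oneSub R hR), fun _ => rfl⟩

end Perturbation

/-! ### Invertibility on L² by almost orthogonality across scales. -/

namespace SmoothAlpert

variable {d κ : ℕ} {Φ : AlpertMollifier d κ}

section

variable {N : ℕ} (A : SmoothAlpert Φ N) {𝕜 : Type*} [RCLike 𝕜]

lemma boundedInvertible_of_bound (hd : 1 ≤ d) (hκ : 0 < κ) {E : ℝ} (hE0 : 0 ≤ E) (hE1 : E < 1)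
    (hE : ∀ (F : Finset (CubeIndex d × Fin N)) (c : CubeIndex d × Fin N → 𝕜),
      ‖∑ k ∈ F, c k • (A.hLp 𝕜 2 k - A.hηLp 𝕜 2 k)‖ ^ 2 ≤ E * ∑ k ∈ F, ‖c k‖ ^ 2) :
    A.BoundedInvertible 𝕜 2 := by
  obtain ⟨b, hb⟩ := A.exists_hilbertBasis (𝕜 := 𝕜) hd hκ
  obtain ⟨R, hR, hsum⟩ := exists_perturbation b _ hE0 hE1 hE
  have hbasis : ∀ f, HasSum (fun k => (inner 𝕜 (A.hLp 𝕜 2 k) f : 𝕜) • A.hLp 𝕜 2 k) f := by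
    intro f
    simpa only [b.repr_apply_apply, hb] using b.hasSum_repr f
  simp_rw [hb] at hsum
  have hRk : ∀ k, A.hLp 𝕜 2 k - R (A.hLp 𝕜 2 k) = A.hηLp 𝕜 2 k := by
    intro k
    have h1 := hasSum_single (f := fun j => (inner 𝕜 (A.hLp 𝕜 2 j) (A.hLp 𝕜 2 k) : 𝕜) •
      (A.hLp 𝕜 2 j - A.hηLp 𝕜 2 j)) k fun j hj => by
        rw [(A.orthonormal_hLp 𝕜 hκ).2 hj, zero_smul]
    rw [(hsum _).unique h1, inner_self_eq_norm_sq_to_K, (A.orthonormal_hLp 𝕜 hκ).1]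
    simp
  have hS : ∀ f, HasSum (A.termS f) (f - R f) := by
    intro f
    convert! (hbasis f).sub (hsum f) using 1
    ext1 k
    rw [termS, ← inner_eq_pairing (A.coeFn_hLp 𝕜 k), ← smul_sub, sub_sub_cancel]
  -- The coefficient of f - R^* f at h_k is ⟨h_k - R h_k, f⟩ = ⟨h_k^η, f⟩. The series for `Sstar` is
  -- thus a basis expansion, and its convergence needs no further estimate.
  have hSs : ∀ f, HasSum (A.termSstar f) (f - ContinuousLinearMap.adjoint R f) := by
    intro f
    convert! hbasis (f - ContinuousLinearMap.adjoint R f) using 1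
    ext1 k
    rw [termSstar, ← inner_eq_pairing (A.coeFn_hηLp 𝕜 k), ← hRk, inner_sub_left, inner_sub_right,
      ContinuousLinearMap.adjoint_inner_right]
  obtain ⟨e, he⟩ := exists_equiv_one_sub hR
  obtain ⟨e', he'⟩ := exists_equiv_one_sub (R := ContinuousLinearMap.adjoint R)
    (by rwa [LinearIsometryEquiv.norm_map])
  exact ⟨fun f => (hS f).summable, fun f => (hSs f).summable,
    ⟨e, fun f => by rw [he, S, (hS f).tsum_eq]⟩, ⟨e', fun f => by rw [he', Sstar, (hSs f).tsum_eq]⟩⟩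

variable (𝕜)

/-- The span of the wavelets of the cubes of side `2^{-s}`. -/
noncomputable def scaleSpan (s : ℤ) : Set (L2Space 𝕜 d) :=
  {v | ∃ (F : Finset (Fin d → ℤ)) (u : (Fin d → ℤ) → L2Space 𝕜 d),
    (∀ m, u m ∈ A.cubeSpan 𝕜 (s, m)) ∧ v = ∑ m ∈ F, u m}

variable {𝕜}

lemma sum_mem_scaleSpan (s : ℤ) (F : Finset (CubeIndex d × Fin N)) (hF : ∀ k ∈ F, k.1.1 = s)
    (c : CubeIndex d × Fin N → 𝕜) : ∑ k ∈ F, c k • A.hLp 𝕜 2 k ∈ A.scaleSpan 𝕜 s := by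
  refine ⟨F.image fun k => k.1.2, fun m => ∑ k ∈ F with k.1.2 = m, c k • A.hLp 𝕜 2 k,
    fun m => Submodule.sum_mem _ fun k hk => ?_,
    (Finset.sum_fiberwise_of_maps_to (fun k hk => Finset.mem_image_of_mem _ hk) _).symm⟩
  obtain ⟨h1, rfl⟩ := Finset.mem_filter.1 hk
  rw [← hF k h1]
  exact Submodule.smul_mem _ _ (Submodule.subset_span ⟨k.2, rfl⟩)

lemma setIntegral_eq_zero_of_mem_scaleSpan (hκ : 0 < κ) {s : ℤ} {v : L2Space 𝕜 d}
    (hv : v ∈ A.scaleSpan 𝕜 s) (m : Fin d → ℤ) : ∫ x in A.G.cube (s, m), v x = 0 := by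
  obtain ⟨F, u, hu, rfl⟩ := hv
  rw [setIntegral_congr_ae (A.G.measurableSet_cube _)
    ((Lp.coeFn_finsetSum F u).mono fun x hx _ => hx)]
  simp only [Finset.sum_apply]
  have hint : ∀ i ∈ F, Integrable (u i) (volume.restrict (A.G.cube (s, m))) := fun i _ =>
    integrableOn_cube _ _ (u i)
  rw [integral_finsetSum _ hint]
  exact Finset.sum_eq_zero fun i _ => A.setIntegral_eq_zero_of_mem_cubeSpan hκ (hu i) m

end

variable (𝕜 : Type*) [RCLike 𝕜]

/-- Almost orthogonality of the errors `v - v * φ` at different scales. -/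
lemma exists_norm_inner_sub_mollify_le (hκ : 0 < κ) (Φ : AlpertMollifier d κ) :
    ∃ K, 0 ≤ K ∧ ∀ (N : ℕ) (A : SmoothAlpert Φ N), A.η ≤ 1 → ∀ (s : ℤ) (n : ℕ),
      ∀ v ∈ A.scaleSpan 𝕜 s, ∀ w ∈ A.scaleSpan 𝕜 (s + n),
      ‖inner 𝕜 (v - Φ.mollify (A.η * (2 : ℝ) ^ (-s)) v)
        (w - Φ.mollify (A.η * (2 : ℝ) ^ (-(s + n))) w)‖ ≤
        K * √A.η * √(√(1 / 2)) ^ n * (‖v‖ * ‖w‖) := by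
  obtain ⟨C, hC0, hC⟩ := exists_norm_lpTranslate_sum_sub_le (Φ := Φ) 𝕜 hκ
  set c := ∫ y, |Φ.φ y|
  have hc0 : 0 ≤ c := integral_nonneg fun y => abs_nonneg _
  have hmod : ∀ (N : ℕ) (A : SmoothAlpert Φ N) (s : ℤ), ∀ v ∈ A.scaleSpan 𝕜 s, ∀ y : RSpace d,
      (∀ i, |y i| ≤ (2 : ℝ) ^ (-s)) →
      ‖lpTranslate y v - v‖ ≤ C * √(‖y‖ * (2 : ℝ) ^ s) * ‖v‖ := by
    rintro N A s _ ⟨F, u, hu, rfl⟩ y hy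
    exact hC N A s F u hu y hy
  -- Mollifying at scale η 2^{-s} only involves translations with ‖y‖ ≤ η 2^{-s}; `A.η ≤ 1` keeps
  -- them in the range where `hmod` applies.
  have hsmall : ∀ (N : ℕ) (A : SmoothAlpert Φ N), A.η ≤ 1 → ∀ (s : ℤ), ∀ v ∈ A.scaleSpan 𝕜 s,
      ‖v - Φ.mollify (A.η * (2 : ℝ) ^ (-s)) v‖ ≤ c * (C * √A.η * ‖v‖) := by
    intro N A hη s v hv
    have hs : (0 : ℝ) < (2 : ℝ) ^ s := by positivity
    refine Φ.norm_sub_mollify_le (mul_pos A.η_pos (by positivity)) fun y hy => ?_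
    refine (hmod N A s v hv y fun i => ?_).trans ?_
    · refine (abs_apply_le_norm y i).trans (hy.trans ?_)
      exact mul_le_of_le_one_left (by positivity) hη
    · gcongr
      calc ‖y‖ * (2 : ℝ) ^ s ≤ A.η * (2 : ℝ) ^ (-s) * (2 : ℝ) ^ s := by gcongr
        _ = A.η := by rw [zpow_neg, mul_assoc, inv_mul_cancel₀ hs.ne', mul_one]
  set B := c ^ 2 * (4 * (2 ^ d * (C * √d)))
  have hB0 : 0 ≤ B := by positivity
  refine ⟨√((c * C) ^ 2 * B), Real.sqrt_nonneg _, fun N A hη s n v hv w hw => ?_⟩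
  set X := ‖inner 𝕜 (v - Φ.mollify (A.η * (2 : ℝ) ^ (-s)) v)
        (w - Φ.mollify (A.η * (2 : ℝ) ^ (-(s + n))) w)‖
  have hη0 := A.η_pos
  have h1 : X ≤ (c * C) ^ 2 * A.η * (‖v‖ * ‖w‖) := by
    calc X ≤ (c * (C * √A.η * ‖v‖)) * (c * (C * √A.η * ‖w‖)) :=
          (norm_inner_le_norm _ _).trans (mul_le_mul (hsmall N A hη s v hv)
            (hsmall N A hη _ w hw) (norm_nonneg _) (by positivity))
      _ = (c * C) ^ 2 * (√A.η * √A.η) * (‖v‖ * ‖w‖) := by ring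
      _ = _ := by rw [Real.mul_self_sqrt hη0.le]
  have h2 : X ≤ B * √(1 / 2) ^ n * (‖v‖ * ‖w‖) := by
    -- A translate of `v` is not adapted to the grid, but it has the same modulus of continuity as
    -- `v`, since translations commute and are isometries. At the finer side length that modulus is
    -- of order √(d 2^{-n}), and `w` has mean zero on the finer cubes.
    have hpair : ∀ y : RSpace d, ‖inner 𝕜 (lpTranslate y v) w‖ ≤
        2 ^ d * (C * (√d * √(1 / 2) ^ n) * ‖v‖) * ‖w‖ := by
      intro y
      refine norm_inner_le_of_setIntegral_eq_zero A.G (s + n) _ w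
        (A.setIntegral_eq_zero_of_mem_scaleSpan hκ hw) fun z hz => ?_
      have h3 : lpTranslate z (lpTranslate y v) - lpTranslate y v =
          lpTranslate y (lpTranslate z v - v) := by
        rw [map_sub, lpTranslate_lpTranslate, lpTranslate_lpTranslate, add_comm]
      rw [h3, LinearIsometry.norm_map]
      have h4 : (2 : ℝ) ^ (-(s + n : ℤ)) = (2 : ℝ) ^ (-s) * (1 / 2) ^ n := by
        rw [neg_add, zpow_add₀ two_ne_zero, zpow_neg _ (n : ℤ), zpow_natCast, one_div, inv_pow]
      refine (hmod N A s v hv z fun i => (hz i).trans ?_).trans ?_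
      · rw [h4]
        exact mul_le_of_le_one_right (by positivity) (pow_le_one₀ (by norm_num) (by norm_num))
      · have hs : (0 : ℝ) < (2 : ℝ) ^ s := by positivity
        have h5 : ‖z‖ * (2 : ℝ) ^ s ≤ d * (1 / 2) ^ n := by
          have h6 := norm_le_mul_of_abs_apply_le hz
          calc ‖z‖ * (2 : ℝ) ^ s ≤ d * ((2 : ℝ) ^ (-s) * (1 / 2) ^ n) * (2 : ℝ) ^ s := by
                rw [← h4]; gcongr
            _ = d * (1 / 2) ^ n * ((2 : ℝ) ^ (-s) * (2 : ℝ) ^ s) := by ring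
            _ = _ := by rw [zpow_neg, inv_mul_cancel₀ hs.ne', mul_one]
        have h6 : √(d * (1 / 2 : ℝ) ^ n) = √d * √(1 / 2) ^ n := by
          rw [Real.sqrt_eq_iff_eq_sq (by positivity) (by positivity), mul_pow,
            Real.sq_sqrt (by positivity), ← pow_mul, mul_comm n 2, pow_mul,
            Real.sq_sqrt (by norm_num)]
        rw [← h6]
        gcongr
    refine (Φ.norm_inner_sub_mollify_sub_mollify_le (mul_pos hη0 (by positivity))
      (mul_pos hη0 (by positivity)) hpair).trans (le_of_eq ?_)
    simp only [B, c]
    ring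
  have hX0 : 0 ≤ X := norm_nonneg _
  -- The geometric mean of `h1` and `h2`: the first supplies smallness in η, the second decay in
  -- `n`, and the product keeps a square root of each.
  refine le_of_sq_le_sq ?_ (by positivity)
  calc X ^ 2 = X * X := sq X
    _ ≤ ((c * C) ^ 2 * A.η * (‖v‖ * ‖w‖)) * (B * √(1 / 2) ^ n * (‖v‖ * ‖w‖)) :=
        mul_le_mul h1 h2 hX0 (by positivity)
    _ = ((c * C) ^ 2 * B) * A.η * √(1 / 2) ^ n * (‖v‖ * ‖w‖) ^ 2 := by ring
    _ = √((c * C) ^ 2 * B) ^ 2 * √A.η ^ 2 * (√(√(1 / 2)) ^ n) ^ 2 * (‖v‖ * ‖w‖) ^ 2 := by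
      rw [Real.sq_sqrt (by positivity), Real.sq_sqrt hη0.le, ← pow_mul, mul_comm n 2, pow_mul,
        Real.sq_sqrt (by positivity)]
    _ = _ := by ring

lemma summable_pow_natAbs {ρ : ℝ} (h0 : 0 ≤ ρ) (h1 : ρ < 1) :
    Summable fun t : ℤ => ρ ^ t.natAbs := by
  refine Summable.of_nat_of_neg ?_ ?_ <;> simpa using summable_geometric_of_lt_one h0 h1

/-- The wavelets and the smooth wavelets are close, uniformly over all square-summable
combinations. -/
lemma exists_norm_sq_sum_sub_le (hκ : 0 < κ) (Φ : AlpertMollifier d κ) :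
    ∃ K, 0 ≤ K ∧ ∀ (N : ℕ) (A : SmoothAlpert Φ N), A.η ≤ 1 →
      ∀ (F : Finset (CubeIndex d × Fin N)) (c : CubeIndex d × Fin N → 𝕜),
      ‖∑ k ∈ F, c k • (A.hLp 𝕜 2 k - A.hηLp 𝕜 2 k)‖ ^ 2 ≤ K * √A.η * ∑ k ∈ F, ‖c k‖ ^ 2 := by
  obtain ⟨K, hK0, hK⟩ := exists_norm_inner_sub_mollify_le 𝕜 hκ Φ
  set ρ := √(√(1 / 2 : ℝ)) with hρ
  have hρ0 : 0 ≤ ρ := Real.sqrt_nonneg _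
  have hρ1 : ρ < 1 := by
    rw [hρ, Real.sqrt_lt' one_pos, Real.sqrt_lt' (by norm_num)]
    norm_num
  have hsum := summable_pow_natAbs hρ0 hρ1
  set L := ∑' t : ℤ, ρ ^ t.natAbs
  have hL0 : 0 ≤ L := tsum_nonneg fun t => pow_nonneg hρ0 _
  refine ⟨K * L, by positivity, fun N A hη F c => ?_⟩
  have hη0 := A.η_pos
  -- The finite sum is grouped by scale, since all wavelets of one scale are mollified with the same
  -- parameter; `x s` is then the error at scale `s`.
  set v : ℤ → L2Space 𝕜 d := fun s => ∑ k ∈ F with k.1.1 = s, c k • A.hLp 𝕜 2 k with hv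
  have hvs : ∀ s, v s ∈ A.scaleSpan 𝕜 s := fun s =>
    A.sum_mem_scaleSpan s _ (fun k hk => (Finset.mem_filter.1 hk).2) c
  set x : ℤ → L2Space 𝕜 d := fun s => v s - Φ.mollify (A.η * (2 : ℝ) ^ (-s)) (v s) with hx
  have hxs : ∀ s, x s = ∑ k ∈ F with k.1.1 = s, c k • (A.hLp 𝕜 2 k - A.hηLp 𝕜 2 k) := by
    intro s
    simp only [hx, hv]
    rw [Φ.mollify_sum (mul_pos hη0 (by positivity)), ← Finset.sum_sub_distrib]
    refine Finset.sum_congr rfl fun k hk => ?_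
    rw [smul_sub, ← A.mollify_hLp 𝕜 k, CubeIndex.side, (Finset.mem_filter.1 hk).2]
  have hsplit : ∑ k ∈ F, c k • (A.hLp 𝕜 2 k - A.hηLp 𝕜 2 k) =
      ∑ s ∈ F.image fun k => k.1.1, x s := by
    simp_rw [hxs]
    exact (Finset.sum_fiberwise_of_maps_to (fun k hk => Finset.mem_image_of_mem _ hk) _).symm
  have hle : ∀ s t : ℤ, s ≤ t → ‖inner 𝕜 (x s) (x t)‖ ≤
      K * √A.η * ρ ^ (s - t).natAbs * (‖v s‖ * ‖v t‖) := by
    intro s t hst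
    obtain ⟨n, rfl⟩ := Int.le.dest hst
    have := hK N A hη s n (v s) (hvs s) (v (s + n)) (hvs _)
    rwa [show (s - (s + n)).natAbs = n by omega]
  have hschur := norm_sq_sum_le_of_schur (𝕜 := 𝕜) (F.image fun k => k.1.1) x (fun s => ‖v s‖)
    (fun s t => K * √A.η * ρ ^ (s - t).natAbs) (fun s t => by positivity)
    (fun s t => by rw [← Int.natAbs_neg, neg_sub])
    (fun s _ t _ => by
      rcases le_total s t with h | h
      · exact hle s t h
      · rw [norm_inner_symm, ← Int.natAbs_neg, neg_sub, mul_comm ‖v s‖]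
        exact hle t s h)
    -- Each row sum is part of a two-sided geometric series with total `L`, recentred at `s`.
    (K := K * L * √A.η) (fun s _ => by
      rw [← Finset.mul_sum, mul_right_comm]
      gcongr
      have hL : L = ∑' t, ρ ^ (s - t).natAbs :=
        ((Equiv.subLeft s).tsum_eq fun t : ℤ => ρ ^ t.natAbs).symm
      rw [hL]
      exact ((Equiv.subLeft s).summable_iff.2 hsum).sum_le_tsum _ fun t _ => pow_nonneg hρ0 _)
  rw [hsplit]
  refine hschur.trans (le_of_eq ?_)
  congr 1
  rw [← Finset.sum_fiberwise_of_maps_to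
    (fun k hk => Finset.mem_image_of_mem (fun k : CubeIndex d × Fin N => k.1.1) hk)
    fun k => ‖c k‖ ^ 2]
  exact Finset.sum_congr rfl fun s _ => norm_sq_sum_smul (A.orthonormal_hLp 𝕜 hκ) c _

lemma exists_boundedInvertible (hd : 1 ≤ d) (hκ : 0 < κ) (Φ : AlpertMollifier d κ) :
    ∃ η₀ : ℝ, 0 < η₀ ∧ ∀ (N : ℕ) (A : SmoothAlpert Φ N), A.η < η₀ → A.BoundedInvertible 𝕜 2 := by
  obtain ⟨K, hK0, hK⟩ := exists_norm_sq_sum_sub_le 𝕜 hκ Φ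
  -- This choice gives (K + 1) √η < 1, hence K √η < 1 even when `K = 0`.
  refine ⟨min 1 ((1 / (K + 1)) ^ 2), by positivity, fun N A hA => ?_⟩
  obtain ⟨h1, h2⟩ := lt_min_iff.1 hA
  refine A.boundedInvertible_of_bound hd hκ (by positivity) ?_ (hK N A h1.le)
  have h3 : √A.η < 1 / (K + 1) := (Real.sqrt_lt' (by positivity)).2 h2
  rw [lt_div_iff₀ (by positivity)] at h3
  nlinarith [Real.sqrt_nonneg A.η, Real.sqrt_pos.2 A.η_pos]

end SmoothAlpert

theorem mainTheorem9 {𝕜 : Type*} [RCLike 𝕜] (d κ : ℕ) (hd : 1 ≤ d) (hκ : (d : ℝ) / 2 < κ)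
    (Φ : AlpertMollifier d κ) :
    -- on `L²` the operators are bounded and invertible for all small `η`, uniformly in the grid
    (∃ η₀ : ℝ, 0 < η₀ ∧ ∀ (N : ℕ) (A : SmoothAlpert Φ N), A.η < η₀ →
      A.BoundedInvertible 𝕜 2) ∧
    -- whenever `T⁻¹` is defined on `L^p`, biorthogonality holds and `Q` is a projection
    (∀ (N : ℕ) (A : SmoothAlpert Φ N) (p : ℝ≥0∞) [Fact (1 ≤ p)], 1 < p → p < ⊤ →
      A.BoundedInvertible 𝕜 p →
        (∀ j k : CubeIndex d × Fin N,
          pairing (A.Tinv (A.hηLp 𝕜 p j)) (A.hη k) = if j = k then 1 else 0) ∧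
        ∀ (s : ℤ) (U : Set (RSpace d)) (hU : Bornology.IsBounded U),
          IsBoundedProjection (A.QInside (𝕜 := 𝕜) (p := p) s hU) ∧
          IsBoundedProjection (A.QMeeting (𝕜 := 𝕜) (p := p) s hU)) := by
  have hκ0 : 0 < κ := by
    have h : (0 : ℝ) < κ := lt_of_le_of_lt (by positivity) hκ
    exact_mod_cast h
  refine ⟨SmoothAlpert.exists_boundedInvertible 𝕜 hd hκ0 Φ, ?_⟩
  intro N A p _ _ _ h
  exact ⟨A.pairing_Tinv_hηLp hκ0 h, fun s U hU =>
    ⟨A.isBoundedProjection_pseudoproj hκ0 h s _, A.isBoundedProjection_pseudoproj hκ0 h s _⟩⟩
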